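/- For an integral binary quartic form $F = a_4x^4+a_3x^3y+a_2x^2y^2+a_1xy^3+a_0y^4$ put $$I(F) = 12a_4a_0-3a_3a_1+a_2^2, \qquad J(F) = 72a_4a_2a_0+9a_3a_2a_1-27a_4a_1^2-27a_0a_3^2-2a_2^3,$$ and let $H_F$ be its Hessian covariant $$H_F = (3a_3^2-8a_4a_2)x^4+4(a_3a_2-6a_4a_1)x^3y+2(2a_2^2-24a_4a_0-3a_3a_1)x^2y^2+4(a_2a_1-6a_3a_0)xy^3+(3a_1^2-8a_2a_0)y^4.$$ The group $\operatorname{GL}_2(\mathbb{Z})$ acts on such forms by linear substitution of the variables. Let $f = \alpha x^2+\beta xy+\gamma y^2$ be a primitive (coprime coefficients) positive definite integral binary quadratic form, with discriminant $\Delta(f)=\beta^2-4\alpha\gamma$. If $J(F)=0$ and $f^2 \mid H_F$, say that $F$ is reducible of Type 2 (with respect to $f$) if $F = m\,g\,h$ for some non-zero rational number $m$ and two non-proportional integral binary quadratic forms $g,h$ such that $g(\beta x+2\gamma y,-2\alpha x-\beta y)$ is proportional to $g$ and $h(\beta x+2\gamma y,-2\alpha x-\beta y)$ is proportional to $h$.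 For $X>0$ let $R(X)$ be the number of $\operatorname{GL}_2(\mathbb{Z})$-equivalence classes of integral binary quartic forms $F$ with $J(F)=0$ and $I(F)\le X^{1/3}$ for which there is a primitive positive definite integral binary quadratic form $f$ with $f^2\mid H_F$ and $|\Delta(f)|\le X^{2/9}$ such that $F$ is reducible of Type 2 with respect to $f$. **Proposition 9.3.** $R(X)$ is finite for every $X>0$, and $R(X) = O\left(X^{11/36}\log X\right)$ as $X\to\infty$. -/

import Mathlib

open MvPolynomial

namespace BinForm

/-- Substitution action on polynomials in the two variables `x = X 0`, `y = X 1`: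
for `T = (t₁ t₂; t₃ t₄)`, it sends `P(x, y)` to `P(t₁ x + t₂ y, t₃ x + t₄ y)`. -/
noncomputable def subst (T : Matrix (Fin 2) (Fin 2) ℤ) :
    MvPolynomial (Fin 2) ℤ →ₐ[ℤ] MvPolynomial (Fin 2) ℤ :=
  aeval ![C (T 0 0) * X 0 + C (T 0 1) * X 1, C (T 1 0) * X 0 + C (T 1 1) * X 1]

theorem subst_one (P : MvPolynomial (Fin 2) ℤ) : subst 1 P = P := by
  have h : subst 1 = AlgHom.id ℤ (MvPolynomial (Fin 2) ℤ) := by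
    apply MvPolynomial.algHom_ext
    intro i
    fin_cases i <;> simp [subst]
  rw [h]
  rfl

theorem subst_subst (S T : Matrix (Fin 2) (Fin 2) ℤ) (P : MvPolynomial (Fin 2) ℤ) :
    subst T (subst S P) = subst (S * T) P := by
  have h : (subst T).comp (subst S) = subst (S * T) := by
    apply MvPolynomial.algHom_ext
    intro i
    fin_cases i <;>
      simp [subst, Matrix.mul_apply, Fin.sum_univ_two] <;> ring
  rw [← h]
  rfl

/-- An integral binary quadratic form `a x² + b x y + c y²`. -/
@[ext]
structure Quadratic where
  a : ℤ
  b : ℤ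
  c : ℤ

/-- An integral binary quartic form `a₄ x⁴ + a₃ x³ y + a₂ x² y² + a₁ x y³ + a₀ y⁴`. -/
@[ext]
structure Quartic where
  a4 : ℤ
  a3 : ℤ
  a2 : ℤ
  a1 : ℤ
  a0 : ℤ

namespace Quadratic

/-- The form as a polynomial in `ℤ[x, y]`. -/
noncomputable def toPoly (f : Quadratic) : MvPolynomial (Fin 2) ℤ :=
  C f.a * X 0 ^ 2 + C f.b * X 0 * X 1 + C f.c * X 1 ^ 2

/-- The discriminant `Δ(f) = b² - 4 a c`. -/
def disc (f : Quadratic) : ℤ := f.b ^ 2 - 4 * f.a * f.c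

/-- The coefficients are coprime. -/
def IsPrimitive (f : Quadratic) : Prop := ∀ d : ℤ, d ∣ f.a → d ∣ f.b → d ∣ f.c → IsUnit d

/-- `f(x, y) > 0` for all real `(x, y) ≠ (0, 0)`. -/
def IsPosDef (f : Quadratic) : Prop :=
  ∀ x y : ℝ, (x ≠ 0 ∨ y ≠ 0) →
    0 < (f.a : ℝ) * x ^ 2 + (f.b : ℝ) * x * y + (f.c : ℝ) * y ^ 2

/-- The matrix of the substitution `(x, y) ↦ (b x + 2 c y, -2 a x - b y)` attached to `f`. -/
def mat (f : Quadratic) : Matrix (Fin 2) (Fin 2) ℤ := !![f.b, 2 * f.c; -2 * f.a, -f.b]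

end Quadratic

namespace Quartic

/-- The form as a polynomial in `ℤ[x, y]`. -/
noncomputable def toPoly (F : Quartic) : MvPolynomial (Fin 2) ℤ :=
  C F.a4 * X 0 ^ 4 + C F.a3 * X 0 ^ 3 * X 1 + C F.a2 * X 0 ^ 2 * X 1 ^ 2
    + C F.a1 * X 0 * X 1 ^ 3 + C F.a0 * X 1 ^ 4

/-- The invariant `I`. -/
def I (F : Quartic) : ℤ := 12 * F.a4 * F.a0 - 3 * F.a3 * F.a1 + F.a2 ^ 2

/-- The invariant `J`. -/
def J (F : Quartic) : ℤ :=
  72 * F.a4 * F.a2 * F.a0 + 9 * F.a3 * F.a2 * F.a1 - 27 * F.a4 * F.a1 ^ 2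
    - 27 * F.a0 * F.a3 ^ 2 - 2 * F.a2 ^ 3

/-- The Hessian covariant `H_F`. -/
def hessian (F : Quartic) : Quartic where
  a4 := 3 * F.a3 ^ 2 - 8 * F.a4 * F.a2
  a3 := 4 * (F.a3 * F.a2 - 6 * F.a4 * F.a1)
  a2 := 2 * (2 * F.a2 ^ 2 - 24 * F.a4 * F.a0 - 3 * F.a3 * F.a1)
  a1 := 4 * (F.a2 * F.a1 - 6 * F.a3 * F.a0)
  a0 := 3 * F.a1 ^ 2 - 8 * F.a2 * F.a0

/-- Equivalence of integral binary quartic forms under substitutions from `GL₂(ℤ)`. -/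
noncomputable instance setoid : Setoid Quartic where
  r F G := ∃ T : GL (Fin 2) ℤ, G.toPoly = subst T F.toPoly
  iseqv :=
    { refl := fun F => ⟨1, by rw [Units.val_one, subst_one]⟩
      symm := by
        rintro F G ⟨T, hT⟩
        refine ⟨T⁻¹, ?_⟩
        rw [hT, subst_subst, ← Units.val_mul, mul_inv_cancel, Units.val_one, subst_one]
      trans := by
        rintro F G H ⟨T, hT⟩ ⟨S, hS⟩
        refine ⟨T * S, ?_⟩
        rw [hS, hT, subst_subst, Units.val_mul] }

end Quartic

/-- The set of `GL₂(ℤ)`-classes of integral binary quartic forms. -/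
abbrev QuarticClass : Type := Quotient Quartic.setoid

/-- Proportionality over `ℚ` (with denominators cleared), that is, linear dependence of the
two polynomials. -/
def Proportional (P Q : MvPolynomial (Fin 2) ℤ) : Prop :=
  ∃ s t : ℤ, (s ≠ 0 ∨ t ≠ 0) ∧ C s * P = C t * Q

/-- `f² ∣ H_F` in `ℝ[x, y]`. -/
def SqDvdHessian (f : Quadratic) (F : Quartic) : Prop :=
  map (Int.castRingHom ℝ) f.toPoly ^ 2 ∣ map (Int.castRingHom ℝ) F.hessian.toPoly

/-- `F` is reducible of Type 2 with respect to `f = α x² + β x y + γ y²`: one has `F = m g h` with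
`m` a non-zero rational number and `g, h` non-proportional integral quadratic forms, each of them
proportional to its image under `(x, y) ↦ (β x + 2 γ y, -2 α x - β y)`. -/
def IsType2 (f : Quadratic) (F : Quartic) : Prop :=
  ∃ (g h : Quadratic) (m : ℚ), m ≠ 0 ∧
    ¬ Proportional g.toPoly h.toPoly ∧
    Proportional (subst f.mat g.toPoly) g.toPoly ∧
    Proportional (subst f.mat h.toPoly) h.toPoly ∧
    map (Int.castRingHom ℚ) F.toPoly =
      C m * map (Int.castRingHom ℚ) g.toPoly * map (Int.castRingHom ℚ) h.toPoly

/-- The `GL₂(ℤ)`-classes of integral binary quartic forms `F` with `J(F) = 0` and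
`I(F) ≤ X^{1/3}` for which there is a primitive positive definite integral binary quadratic form
`f` with `f² ∣ H_F` and `|Δ(f)| ≤ X^{2/9}` such that `F` is reducible of Type 2 with respect
to `f`. -/
def type2Classes (X : ℝ) : Set QuarticClass :=
  {w | ∃ F : Quartic, Quotient.mk Quartic.setoid F = w ∧ F.J = 0 ∧
    (F.I : ℝ) ≤ X ^ ((1 : ℝ) / 3) ∧
    ∃ f : Quadratic, f.IsPrimitive ∧ f.IsPosDef ∧ SqDvdHessian f F ∧
      |(f.disc : ℝ)| ≤ X ^ ((2 : ℝ) / 9) ∧ IsType2 f F}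

end BinForm

/-!
If `F` is reducible of Type 2 with respect to `f`, its Hessian vanishes at the complex roots of `f`,
and this forces `F = n g h` with an integer `n` and primitive forms `g, h` such that `f, g, h` are
mutually orthogonal in the ternary quadratic space of binary quadratic forms with the discriminant
(`orthogonal_of_isType2`, `exists_frame_of_isType2`). The cross product of any two of them is then
a multiple of the third; with multiples `k, k', l` one has
`disc f = -k k'`, `disc g = k l`, `disc h = k' l`, `4 I(F) = 3 n² k k' l²`, and
`l f² = k' g² + k h²`. So `(f : g : h)` parametrises the conic `l X² = k' Y² + k Z²`, and the bounds
for `I(F)` and `disc f` give `|n| m ≤ 2 X ^ (5 / 18)` for `m = k k' l`.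

It remains to count the frames with given `k, k', l` up to `SL₂(ℤ)`. Fix a primitive integral point
`P = (p, q, r)` of the conic. Every frame passes through `P`, and after a substitution it does so at
`(1, 0)`, with first row `δ P` (`IsFrame.exists_normalized`). Here `δ` divides `m`. The middle rows
of two such frames differ by `t P`, where `2 δ` divides `ρ t` for `ρ = gcd (l p, k' q, k r)`, and
translations `x ↦ x + w y` change `t` by multiples of `2 δ`; so at most `ρ` classes share a given
`δ`. Finally `ρ² ∣ m` because `P` is primitive and lies on the conic (`sq_dvd_of_conic`). These
facts make up `exists_frame_invariant`.

Hence the number of classes is at most `2 ∑ d(m)³ s(m)` over pairs with `n m ≤ N = 2 X ^ (5 / 18)`,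
where `s(m)` is the sum of the `s` with `s² ∣ m`. The sum of `s(m)` over these pairs is at most
`N (1 + log N)²`, and the divisor bound `d(m) = O(m ^ ε)` gives `O(N ^ (13 / 12))`
(`exists_card_codes_le`). This is `O(X ^ (65 / 216))`, below the required order since
`65 / 216 < 11 / 36`.
-/

namespace BinForm

/-! ### Quadratic forms as a ternary quadratic space -/

namespace Quadratic

/-- The polar form of the discriminant, normalised so that `B(f, f) = disc f`. -/
def polar (f g : Quadratic) : ℤ := f.b * g.b - 2 * f.a * g.c - 2 * f.c * g.a

/-- Half of the Jacobian `f_x g_y - f_y g_x`: the cross product of the ternary quadratic space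
of binary quadratic forms with the discriminant. -/
def jac (f g : Quadratic) : Quadratic where
  a := f.a * g.b - f.b * g.a
  b := 2 * (f.a * g.c - f.c * g.a)
  c := f.b * g.c - f.c * g.b

/-- The form `g(T₀₀ x + T₀₁ y, T₁₀ x + T₁₁ y)`. -/
def act (g : Quadratic) (T : Matrix (Fin 2) (Fin 2) ℤ) : Quadratic where
  a := g.a * T 0 0 ^ 2 + g.b * T 0 0 * T 1 0 + g.c * T 1 0 ^ 2
  b := 2 * g.a * T 0 0 * T 0 1 + g.b * (T 0 0 * T 1 1 + T 0 1 * T 1 0) + 2 * g.c * T 1 0 * T 1 1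
  c := g.a * T 0 1 ^ 2 + g.b * T 0 1 * T 1 1 + g.c * T 1 1 ^ 2

/-- The multiple `k g` of a form. -/
def smul (k : ℤ) (g : Quadratic) : Quadratic := ⟨k * g.a, k * g.b, k * g.c⟩

@[simp] theorem smul_a (k : ℤ) (g : Quadratic) : (smul k g).a = k * g.a := rfl
@[simp] theorem smul_b (k : ℤ) (g : Quadratic) : (smul k g).b = k * g.b := rfl
@[simp] theorem smul_c (k : ℤ) (g : Quadratic) : (smul k g).c = k * g.c := rfl

theorem subst_toPoly (T : Matrix (Fin 2) (Fin 2) ℤ) (g : Quadratic) :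
    subst T g.toPoly = (g.act T).toPoly := by
  simp only [subst, toPoly, act, map_add, map_mul, map_pow, aeval_X, aeval_C,
    Matrix.cons_val_zero, Matrix.cons_val_one, algebraMap_eq, map_ofNat]
  ring

theorem act_mat (f g : Quadratic) :
    (g.act f.mat).a = f.disc * g.a - 2 * polar f g * f.a ∧
    (g.act f.mat).b = f.disc * g.b - 2 * polar f g * f.b ∧
    (g.act f.mat).c = f.disc * g.c - 2 * polar f g * f.c := by
  simp only [act, mat, disc, polar, Matrix.of_apply, Matrix.cons_val_zero, Matrix.cons_val_one,
    Matrix.cons_val', Matrix.cons_val_fin_one]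
  refine ⟨by ring, by ring, by ring⟩

theorem eval_toPoly (g : Quadratic) (x y : ℤ) :
    eval ![x, y] g.toPoly = g.a * x ^ 2 + g.b * x * y + g.c * y ^ 2 := by
  simp [toPoly]

theorem smul_toPoly (k : ℤ) (g : Quadratic) : C k * g.toPoly = (smul k g).toPoly := by
  simp only [toPoly, smul, C_mul]
  ring

theorem toPoly_injective : Function.Injective toPoly := by
  intro g h e
  have H := fun x y => congrArg (eval ![x, y]) e
  simp only [eval_toPoly] at H
  have h1 := H 1 0
  have h2 := H 0 1
  have h3 := H 1 1
  ext <;> linarith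

theorem proportional_iff (g h : Quadratic) :
    Proportional g.toPoly h.toPoly ↔ ∃ s t : ℤ, (s ≠ 0 ∨ t ≠ 0) ∧ smul s g = smul t h := by
  simp only [Proportional, smul_toPoly, toPoly_injective.eq_iff]

/-- The coefficients have no common factor, as a Bézout identity. -/
theorem IsPrimitive.bezout {g : Quadratic} (hg : g.IsPrimitive) :
    ∃ x y z : ℤ, x * g.a + y * g.b + z * g.c = 1 := by
  obtain ⟨u, v, huv⟩ : ∃ u v : ℤ, (Int.gcd g.a g.b : ℤ) = g.a * u + g.b * v :=
    ⟨_, _, Int.gcd_eq_gcd_ab _ _⟩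
  have hu : IsCoprime (Int.gcd g.a g.b : ℤ) g.c := by
    rw [Int.isCoprime_iff_gcd_eq_one]
    have h1 : IsUnit (Int.gcd (Int.gcd g.a g.b) g.c : ℤ) := by
      refine hg _ ?_ ?_ ?_
      · exact (Int.gcd_dvd_left ..).trans (Int.gcd_dvd_left ..)
      · exact (Int.gcd_dvd_left ..).trans (Int.gcd_dvd_right ..)
      · exact Int.gcd_dvd_right ..
    simpa [Int.isUnit_iff_natAbs_eq] using h1
  obtain ⟨p, q, hpq⟩ := hu
  exact ⟨p * u, p * v, q, by rw [← hpq, huv]; ring⟩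

/-- Every non-zero form is a non-zero multiple of a primitive one. -/
theorem exists_primitive (g : Quadratic) (hg : g ≠ ⟨0, 0, 0⟩) :
    ∃ (c : ℤ) (g' : Quadratic), c ≠ 0 ∧ g'.IsPrimitive ∧ g = smul c g' := by
  set d : ℤ := (Int.gcd (Int.gcd g.a g.b) g.c : ℤ) with hd
  have da : d ∣ g.a := (Int.gcd_dvd_left ..).trans (Int.gcd_dvd_left ..)
  have db : d ∣ g.b := (Int.gcd_dvd_left ..).trans (Int.gcd_dvd_right ..)
  have dc : d ∣ g.c := Int.gcd_dvd_right ..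
  obtain ⟨a, ha⟩ := da
  obtain ⟨b, hb⟩ := db
  obtain ⟨c, hc⟩ := dc
  have hd0 : d ≠ 0 := by
    intro h0
    apply hg
    ext
    · rw [ha, h0, zero_mul]
    · rw [hb, h0, zero_mul]
    · rw [hc, h0, zero_mul]
  refine ⟨d, ⟨a, b, c⟩, hd0, ?_, Quadratic.ext ha hb hc⟩
  rintro e ⟨a', ha'⟩ ⟨b', hb'⟩ ⟨c', hc'⟩
  simp only at ha' hb' hc'
  have h1 : d * e ∣ d := by
    conv_rhs => rw [hd]
    refine Int.dvd_coe_gcd (Int.dvd_coe_gcd ⟨a', ?_⟩ ⟨b', ?_⟩) ⟨c', ?_⟩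
    · rw [ha, ha']; ring
    · rw [hb, hb']; ring
    · rw [hc, hc']; ring
  have h2 : d * e ∣ d * 1 := by simpa using h1
  exact isUnit_of_dvd_one ((mul_dvd_mul_iff_left hd0).1 h2)

theorem IsPosDef.a_pos {f : Quadratic} (hf : f.IsPosDef) : 0 < f.a := by
  have := hf 1 0 (by simp)
  simp at this
  exact_mod_cast this

theorem IsPosDef.disc_neg {f : Quadratic} (hf : f.IsPosDef) : f.disc < 0 := by
  have h := hf (-f.b) (2 * f.a) (Or.inr (by have := hf.a_pos; positivity))
  have h1 : (0 : ℝ) < ((-f.disc * f.a : ℤ) : ℝ) := by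
    rw [disc]; push_cast; linarith
  have h2 : 0 < -f.disc * f.a := by exact_mod_cast h1
  nlinarith [hf.a_pos]

end Quadratic

/-! ### Products of quadratic forms -/

namespace Quartic

/-- The product of two quadratic forms. -/
def prod (g h : Quadratic) : Quartic where
  a4 := g.a * h.a
  a3 := g.a * h.b + g.b * h.a
  a2 := g.a * h.c + g.b * h.b + g.c * h.a
  a1 := g.b * h.c + g.c * h.b
  a0 := g.c * h.c

/-- The multiple `n F` of a form. -/
def smul (n : ℤ) (F : Quartic) : Quartic := ⟨n * F.a4, n * F.a3, n * F.a2, n * F.a1, n * F.a0⟩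

theorem smul_prod_toPoly (n : ℤ) (g h : Quadratic) :
    (smul n (prod g h)).toPoly = C n * g.toPoly * h.toPoly := by
  simp only [toPoly, smul, prod, Quadratic.toPoly, C_mul, C_add]
  ring

/-- Gauss's lemma: if `(p / q) g h` is integral, with `p / q` in lowest terms and `g, h` primitive,
then `p / q` is an integer. -/
theorem isUnit_denominator_of_primitive {g h : Quadratic} (hg : g.IsPrimitive) (hh : h.IsPrimitive)
    {p q : ℤ} (hpq : IsCoprime p q) {F : Quartic} (hF : smul q F = smul p (prod g h)) :
    IsUnit q := by
  have prim : ∀ g : Quadratic, g.IsPrimitive →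
      (Polynomial.C g.a * Polynomial.X ^ 2 + Polynomial.C g.b * Polynomial.X +
        Polynomial.C g.c).IsPrimitive := by
    intro g hg r hr
    rw [Polynomial.C_dvd_iff_dvd_coeff] at hr
    refine hg r ?_ ?_ ?_
    · simpa [-eq_intCast, Polynomial.coeff_X, Polynomial.coeff_C] using hr 2
    · simpa [-eq_intCast, Polynomial.coeff_X, Polynomial.coeff_C] using hr 1
    · simpa [-eq_intCast, Polynomial.coeff_X, Polynomial.coeff_C] using hr 0
  have key := (prim g hg).mul (prim h hh)
  have dv : ∀ x y : ℤ, q * x = p * y → q ∣ y := fun x y e =>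
    hpq.symm.dvd_of_dvd_mul_left ⟨x, e.symm⟩
  obtain ⟨y4, h4⟩ := dv _ _ (congrArg a4 hF)
  obtain ⟨y3, h3⟩ := dv _ _ (congrArg a3 hF)
  obtain ⟨y2, h2⟩ := dv _ _ (congrArg a2 hF)
  obtain ⟨y1, h1⟩ := dv _ _ (congrArg a1 hF)
  obtain ⟨y0, h0⟩ := dv _ _ (congrArg a0 hF)
  simp only [prod] at h4 h3 h2 h1 h0
  refine key q ⟨Polynomial.C y4 * Polynomial.X ^ 4 + Polynomial.C y3 * Polynomial.X ^ 3 +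
    Polynomial.C y2 * Polynomial.X ^ 2 + Polynomial.C y1 * Polynomial.X + Polynomial.C y0, ?_⟩
  have e4 := congrArg (Polynomial.C (R := ℤ)) h4
  have e3 := congrArg (Polynomial.C (R := ℤ)) h3
  have e2 := congrArg (Polynomial.C (R := ℤ)) h2
  have e1 := congrArg (Polynomial.C (R := ℤ)) h1
  have e0 := congrArg (Polynomial.C (R := ℤ)) h0
  simp only [Polynomial.C_mul, Polynomial.C_add] at e4 e3 e2 e1 e0
  linear_combination Polynomial.X ^ 4 * e4 + Polynomial.X ^ 3 * e3 + Polynomial.X ^ 2 * e2 +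
    Polynomial.X * e1 + e0

theorem eval_toPoly (F : Quartic) (x y : ℤ) : eval ![x, y] F.toPoly =
    F.a4 * x ^ 4 + F.a3 * x ^ 3 * y + F.a2 * x ^ 2 * y ^ 2 + F.a1 * x * y ^ 3 + F.a0 * y ^ 4 := by
  simp [toPoly]

theorem toPoly_injective : Function.Injective toPoly := by
  intro g h e
  have H := fun x y => congrArg (eval ![x, y]) e
  simp only [eval_toPoly] at H
  have h1 := H 1 0
  have h2 := H 0 1
  have h3 := H 1 1
  have h4 := H 1 (-1)
  have h5 := H 2 1
  ext <;> linarith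

theorem smul_toPoly (k : ℤ) (g : Quartic) : (smul k g).toPoly = C k * g.toPoly := by
  simp only [toPoly, smul, C_mul]
  ring

/-- The Hessian of a product, at a point `(x, 1)` with `x` in any commutative ring. -/
theorem hessian_smul_prod_eval {R : Type*} [CommRing R] (n : ℤ) (g h : Quadratic) (x : R) :
    let H := (smul n (prod g h)).hessian
    let G : R := g.a * x ^ 2 + g.b * x + g.c
    let K : R := h.a * x ^ 2 + h.b * x + h.c
    (H.a4 * x ^ 4 + H.a3 * x ^ 3 + H.a2 * x ^ 2 + H.a1 * x + H.a0 : R) =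
      (n : R) ^ 2 * (3 * (h.disc * G ^ 2 + g.disc * K ^ 2) - 2 * Quadratic.polar g h * G * K) := by
  simp only [hessian, smul, prod, Quadratic.disc, Quadratic.polar]
  push_cast
  ring

theorem four_I_smul_prod (n : ℤ) (g h : Quadratic) :
    4 * (smul n (prod g h)).I = n ^ 2 * (3 * g.disc * h.disc + Quadratic.polar g h ^ 2) := by
  simp only [I, smul, prod, Quadratic.disc, Quadratic.polar]
  ring

end Quartic

/-! ### Orthogonal frames attached to reducible quartic forms -/

/-- An orthogonal frame of binary quadratic forms, `f` being positive definite: the cross product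
of any two is a multiple of the third, and the positive integers `k, k', l` record the
multiples. -/
structure IsFrame (k k' l : ℕ) (f g h : Quadratic) : Prop where
  k_pos : 0 < k
  k'_pos : 0 < k'
  l_pos : 0 < l
  a_pos : 0 < f.a
  jac_fg : f.jac g = Quadratic.smul k h
  jac_hf : h.jac f = Quadratic.smul k' g
  jac_gh : g.jac h = Quadratic.smul (-l) f
  disc_f : f.disc = -(k * k')
  disc_g : g.disc = k * l
  disc_h : h.disc = k' * l

namespace Quadratic

theorem jac_jac (u f g : Quadratic) :
    (u.jac (f.jac g)).a = polar u f * g.a - polar u g * f.a ∧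
    (u.jac (f.jac g)).b = polar u f * g.b - polar u g * f.b ∧
    (u.jac (f.jac g)).c = polar u f * g.c - polar u g * f.c := by
  simp only [jac, polar]
  refine ⟨by ring, by ring, by ring⟩

theorem polar_self (f : Quadratic) : polar f f = f.disc := by
  simp only [polar, disc]; ring

theorem polar_comm (f g : Quadratic) : polar f g = polar g f := by
  simp only [polar]; ring

theorem jac_smul (c : ℤ) (f g : Quadratic) : f.jac (smul c g) = smul c (f.jac g) := by
  simp only [jac, smul, mk.injEq]
  refine ⟨by ring, by ring, by ring⟩

theorem jac_anticomm (f g : Quadratic) : f.jac g = smul (-1) (g.jac f) := by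
  simp only [jac, smul, mk.injEq]
  refine ⟨by ring, by ring, by ring⟩

theorem disc_mul_eq_of_jac_eq_zero {f g : Quadratic} (h : f.jac g = ⟨0, 0, 0⟩) :
    smul f.disc g = smul (polar f g) f := by
  have H := jac_jac f f g
  rw [h, polar_self] at H
  simp only [jac, mul_zero, sub_self] at H
  ext <;> simp only [smul] <;> linarith [H.1, H.2.1, H.2.2]

/-- A form parallel to a primitive form is an integral multiple of it. -/
theorem IsPrimitive.eq_smul {h w : Quadratic} (hh : h.IsPrimitive) (e : h.jac w = ⟨0, 0, 0⟩) :
    ∃ c : ℤ, w = smul c h := by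
  obtain ⟨x, y, z, hxyz⟩ := hh.bezout
  simp only [jac, mk.injEq, mul_eq_zero, OfNat.ofNat_ne_zero, false_or] at e
  obtain ⟨e1, e2, e3⟩ := e
  refine ⟨x * w.a + y * w.b + z * w.c, ?_⟩
  ext <;> simp only [smul]
  · linear_combination (-w.a) * hxyz - y * e1 - z * e2
  · linear_combination (-w.b) * hxyz + x * e1 - z * e3
  · linear_combination (-w.c) * hxyz + x * e2 + y * e3

/-- Forms orthogonal to a positive definite form have positive discriminant. -/
theorem disc_pos_of_polar_eq_zero {f g : Quadratic} (hf : f.IsPosDef) (hg : g ≠ ⟨0, 0, 0⟩)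
    (h : polar f g = 0) : 0 < g.disc := by
  have ha := hf.a_pos
  have hd := hf.disc_neg
  have e : f.a ^ 2 * g.disc = (f.a * g.b - f.b * g.a) ^ 2 + (-f.disc) * g.a ^ 2 := by
    simp only [disc]
    simp only [polar] at h
    linear_combination (2 * f.a * g.a) * h
  by_contra hn
  push Not at hn
  have h1 : f.a ^ 2 * g.disc ≤ 0 := mul_nonpos_of_nonneg_of_nonpos (sq_nonneg _) hn
  have h2 : (-f.disc) * g.a ^ 2 ≤ 0 := by nlinarith [sq_nonneg (f.a * g.b - f.b * g.a)]
  have h3 : g.a = 0 := by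
    by_contra h0
    have : 0 < g.a ^ 2 := by positivity
    nlinarith
  have h4 : g.b = 0 := by
    by_contra h0
    rw [h3] at e
    have : 0 < (f.a * g.b) ^ 2 := by positivity
    nlinarith
  have h5 : g.c = 0 := by
    simp only [polar, h3, h4] at h
    have : f.a * g.c = 0 := by linarith
    exact (mul_eq_zero.1 this).resolve_left ha.ne'
  exact hg (Quadratic.ext h3 h4 h5)

theorem exists_root {f : Quadratic} (hf : f.IsPosDef) :
    ∃ θ : ℂ, θ.im ≠ 0 ∧ (f.a : ℂ) * θ ^ 2 + f.b * θ + f.c = 0 := by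
  have ha : (0 : ℝ) < f.a := by exact_mod_cast hf.a_pos
  have hd : (0 : ℝ) < -f.disc := by exact_mod_cast neg_pos.2 hf.disc_neg
  obtain ⟨r, hr0, hr⟩ : ∃ r : ℝ, 0 < r ∧ r ^ 2 = -f.disc :=
    ⟨_, Real.sqrt_pos.2 hd, Real.sq_sqrt hd.le⟩
  have hs : (r : ℂ) ^ 2 = -((f.b : ℂ) ^ 2 - 4 * f.a * f.c) := by
    rw [disc] at hr
    exact_mod_cast congrArg (fun x : ℝ => (x : ℂ)) hr
  refine ⟨⟨-f.b / (2 * f.a), r / (2 * f.a)⟩, ?_, ?_⟩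
  · positivity
  · have hac : (f.a : ℂ) ≠ 0 := by exact_mod_cast hf.a_pos.ne'
    rw [Complex.mk_eq_add_mul_I]
    push_cast
    field_simp
    linear_combination (r : ℂ) ^ 2 * Complex.I_sq - hs

/-- Values at a root of `f` detect parallelism to `f`. -/
theorem eval_root_eq_zero_iff {f g : Quadratic} (hf : f.IsPosDef) {θ : ℂ} (hi : θ.im ≠ 0)
    (hθ : (f.a : ℂ) * θ ^ 2 + f.b * θ + f.c = 0) :
    (g.a : ℂ) * θ ^ 2 + g.b * θ + g.c = 0 ↔ f.jac g = ⟨0, 0, 0⟩ := by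
  have ha := hf.a_pos.ne'
  constructor
  · intro h
    have e : ((f.a * g.b - f.b * g.a : ℤ) : ℂ) * θ + ((f.a * g.c - f.c * g.a : ℤ) : ℂ) = 0 := by
      push_cast
      linear_combination (f.a : ℂ) * h - (g.a : ℂ) * hθ
    have e1 : f.a * g.b - f.b * g.a = 0 := by
      have := congrArg Complex.im e
      simp only [Complex.add_im, Complex.mul_im, Complex.intCast_re, Complex.intCast_im,
        zero_mul, add_zero, Complex.zero_im, mul_eq_zero, hi, or_false] at this
      exact_mod_cast this
    have e2 : f.a * g.c - f.c * g.a = 0 := by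
      rw [e1, Int.cast_zero, zero_mul, zero_add] at e
      exact_mod_cast e
    have e3 : f.b * g.c - f.c * g.b = 0 := by
      have : f.a * (f.b * g.c - f.c * g.b) = 0 := by linear_combination f.b * e2 - f.c * e1
      exact (mul_eq_zero.1 this).resolve_left ha
    ext <;> simp only [jac]
    · exact e1
    · rw [e2, mul_zero]
    · exact e3
  · intro h
    simp only [jac, mk.injEq, mul_eq_zero, OfNat.ofNat_ne_zero, false_or] at h
    have hac : (f.a : ℂ) ≠ 0 := by exact_mod_cast ha
    have e1 : ((f.a * g.b - f.b * g.a : ℤ) : ℂ) = 0 := by rw [h.1, Int.cast_zero]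
    have e2 : ((f.a * g.c - f.c * g.a : ℤ) : ℂ) = 0 := by rw [h.2.1, Int.cast_zero]
    push_cast at e1 e2
    have : (f.a : ℂ) * ((g.a : ℂ) * θ ^ 2 + g.b * θ + g.c) = 0 := by
      linear_combination (g.a : ℂ) * hθ + θ * e1 + e2
    exact (mul_eq_zero.1 this).resolve_left hac

/-- A form proportional to its image under the involution of `f` is orthogonal or parallel
to `f`. -/
theorem polar_eq_zero_or_jac_eq_zero {f g : Quadratic} (hf : f.IsPosDef)
    (h : Proportional (subst f.mat g.toPoly) g.toPoly) :
    polar f g = 0 ∨ f.jac g = ⟨0, 0, 0⟩ := by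
  rw [subst_toPoly, proportional_iff] at h
  obtain ⟨s, t, hst, e⟩ := h
  obtain ⟨m1, m2, m3⟩ := act_mat f g
  have ea := congrArg a e
  have eb := congrArg b e
  have ec := congrArg c e
  simp only [smul_a, smul_b, smul_c, m1, m2, m3] at ea eb ec
  by_cases hc : s * f.disc - t = 0
  · left
    have hs : s ≠ 0 := by
      rintro rfl
      have : t = 0 := by linarith
      simp [this] at hst
    have : 2 * (s * (f.a * polar f g)) = 0 := by
      linear_combination g.a * hc - ea
    simpa [hs, hf.a_pos.ne'] using this
  · right
    have key : ∀ x y x' y' : ℤ, s * (f.disc * x' - 2 * polar f g * x) = t * x' →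
        s * (f.disc * y' - 2 * polar f g * y) = t * y' → x * y' - y * x' = 0 := by
      intro x y x' y' hx hy
      have : (s * f.disc - t) * (x * y' - y * x') = 0 := by linear_combination x * hy - y * hx
      exact (mul_eq_zero.1 this).resolve_left hc
    ext <;> simp only [jac]
    · exact key _ _ _ _ ea eb
    · rw [key _ _ _ _ ea ec, mul_zero]
    · exact key _ _ _ _ eb ec

end Quadratic

/-! ### Factorisation of forms reducible of Type 2 -/

theorem SqDvdHessian.hessian_root {f : Quadratic} {F : Quartic} (h : SqDvdHessian f F) {θ : ℂ}
    (hθ : (f.a : ℂ) * θ ^ 2 + f.b * θ + f.c = 0) :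
    (F.hessian.a4 * θ ^ 4 + F.hessian.a3 * θ ^ 3 + F.hessian.a2 * θ ^ 2 + F.hessian.a1 * θ
      + F.hessian.a0 : ℂ) = 0 := by
  obtain ⟨Q, hQ⟩ := h
  have e := congrArg (eval₂Hom (algebraMap ℝ ℂ) ![θ, 1]) hQ
  have e1 : eval₂Hom (algebraMap ℝ ℂ) ![θ, 1] (map (Int.castRingHom ℝ) f.toPoly) = 0 := by
    simpa [Quadratic.toPoly, -coe_eval₂Hom] using hθ
  rw [map_mul, map_pow, e1] at e
  simpa [Quartic.toPoly, -coe_eval₂Hom] using e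

/-- Clearing denominators in a rational factorisation. -/
theorem exists_smul_eq_smul_prod {F : Quartic} {g h : Quadratic} {m : ℚ}
    (hF : map (Int.castRingHom ℚ) F.toPoly =
      C m * map (Int.castRingHom ℚ) g.toPoly * map (Int.castRingHom ℚ) h.toPoly) :
    Quartic.smul m.den F = Quartic.smul m.num (Quartic.prod g h) := by
  apply Quartic.toPoly_injective
  apply map_injective (Int.castRingHom ℚ) Int.cast_injective
  rw [Quartic.smul_prod_toPoly, Quartic.smul_toPoly, map_mul, map_mul, map_mul, hF, map_C, map_C,
    ← mul_assoc, ← mul_assoc, ← C_mul]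
  congr 3
  simp [mul_comm, Rat.mul_den_eq_num]

/-- The two factors of a form which is reducible of Type 2 are orthogonal to `f` and to each
other. The Hessian of `g h` is `3 (disc h g² + disc g h²) - 2 B(g, h) g h`; evaluating at a root
of `f` rules out factors parallel to `f`, and then `disc h g² - 2 B(g, h) g h + disc g h²`, the
square of the Jacobian, vanishes there as well, which leaves `4 B(g, h) g h = 0`. -/
theorem orthogonal_of_isType2 {f : Quadratic} {F : Quartic} (hf : f.IsPosDef)
    (hd : SqDvdHessian f F) {g h : Quadratic} {p q : ℤ} (hp : p ≠ 0)
    (hF : Quartic.smul q F = Quartic.smul p (Quartic.prod g h))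
    (hgh : ¬ Proportional g.toPoly h.toPoly)
    (hg : Proportional (subst f.mat g.toPoly) g.toPoly)
    (hh : Proportional (subst f.mat h.toPoly) h.toPoly) :
    g ≠ ⟨0, 0, 0⟩ ∧ h ≠ ⟨0, 0, 0⟩ ∧ Quadratic.polar f g = 0 ∧ Quadratic.polar f h = 0 ∧
      Quadratic.polar g h = 0 := by
  rw [Quadratic.proportional_iff] at hgh
  have hΔ := hf.disc_neg.ne
  have hg0 : g ≠ ⟨0, 0, 0⟩ := by
    rintro rfl
    exact hgh ⟨1, 0, by simp, by simp [Quadratic.smul]⟩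
  have hh0 : h ≠ ⟨0, 0, 0⟩ := by
    rintro rfl
    exact hgh ⟨0, 1, by simp, by simp [Quadratic.smul]⟩
  obtain ⟨θ, hi, hθ⟩ := Quadratic.exists_root hf
  have key := Quartic.hessian_smul_prod_eval p g h θ
  have hroot := hd.hessian_root hθ
  rw [← hF] at key
  simp only [Quartic.hessian, Quartic.smul] at key hroot
  set G : ℂ := g.a * θ ^ 2 + g.b * θ + g.c with hG
  set K : ℂ := h.a * θ ^ 2 + h.b * θ + h.c with hK
  have hpc : (p : ℂ) ≠ 0 := by exact_mod_cast hp
  have e0 : 3 * ((h.disc : ℂ) * G ^ 2 + g.disc * K ^ 2) - 2 * Quadratic.polar g h * G * K = 0 := by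
    refine (mul_eq_zero.1 (?_ : (p : ℂ) ^ 2 * _ = 0)).resolve_left (pow_ne_zero 2 hpc)
    rw [← key]
    push_cast at hroot ⊢
    linear_combination (q : ℂ) ^ 2 * hroot
  have hGz := Quadratic.eval_root_eq_zero_iff (g := g) hf hi hθ
  have hKz := Quadratic.eval_root_eq_zero_iff (g := h) hf hi hθ
  rw [← hG] at hGz
  rw [← hK] at hKz
  have smul_zero_left : ∀ u : Quadratic, Quadratic.smul f.disc u = ⟨0, 0, 0⟩ → u = ⟨0, 0, 0⟩ := by
    intro u hu
    simpa [Quadratic.smul, hΔ, Quadratic.ext_iff] using hu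
  -- a form parallel to `f` has non-zero polar with `f` and non-zero discriminant
  have par : ∀ u : Quadratic, u ≠ ⟨0, 0, 0⟩ → f.jac u = ⟨0, 0, 0⟩ →
      Quadratic.polar f u ≠ 0 ∧ (u.disc : ℂ) ≠ 0 := by
    intro u hu hj
    have e := Quadratic.disc_mul_eq_of_jac_eq_zero hj
    have hB : Quadratic.polar f u ≠ 0 := by
      intro hB
      rw [hB] at e
      exact hu (smul_zero_left u (by rw [e]; simp [Quadratic.smul]))
    refine ⟨hB, ?_⟩
    have : f.disc ^ 2 * u.disc = Quadratic.polar f u ^ 2 * f.disc := by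
      have ea := congrArg Quadratic.a e
      have eb := congrArg Quadratic.b e
      have ec := congrArg Quadratic.c e
      simp only [Quadratic.smul_a, Quadratic.smul_b, Quadratic.smul_c] at ea eb ec
      have : f.disc ^ 2 * u.disc =
          (f.disc * u.b) ^ 2 - 4 * (f.disc * u.a) * (f.disc * u.c) := by
        rw [Quadratic.disc.eq_def u]; ring
      rw [this, ea, eb, ec]
      rw [Quadratic.disc.eq_def f]
      ring
    intro h0
    have h0' : u.disc = 0 := by exact_mod_cast h0
    rw [h0', mul_zero] at this
    exact mul_ne_zero (pow_ne_zero 2 hB) hΔ this.symm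
  have not_both : ¬ (f.jac g = ⟨0, 0, 0⟩ ∧ f.jac h = ⟨0, 0, 0⟩) := by
    rintro ⟨jg, jh⟩
    have eg := Quadratic.disc_mul_eq_of_jac_eq_zero jg
    have eh := Quadratic.disc_mul_eq_of_jac_eq_zero jh
    refine hgh ⟨Quadratic.polar f h * f.disc, Quadratic.polar f g * f.disc,
      Or.inl (mul_ne_zero (par h hh0 jh).1 hΔ), ?_⟩
    simp only [Quadratic.ext_iff, Quadratic.smul] at eg eh ⊢
    refine ⟨?_, ?_, ?_⟩
    · linear_combination Quadratic.polar f h * eg.1 - Quadratic.polar f g * eh.1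
    · linear_combination Quadratic.polar f h * eg.2.1 - Quadratic.polar f g * eh.2.1
    · linear_combination Quadratic.polar f h * eg.2.2 - Quadratic.polar f g * eh.2.2
  have jg : f.jac g ≠ ⟨0, 0, 0⟩ := by
    intro jg
    have hG0 := hGz.2 jg
    rw [hG0] at e0
    have : K = 0 := by simpa [(par g hg0 jg).2] using e0
    exact not_both ⟨jg, hKz.1 this⟩
  have jh : f.jac h ≠ ⟨0, 0, 0⟩ := by
    intro jh
    have hK0 := hKz.2 jh
    rw [hK0] at e0
    have : G = 0 := by simpa [(par h hh0 jh).2] using e0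
    exact not_both ⟨hGz.1 this, jh⟩
  have Bg := (Quadratic.polar_eq_zero_or_jac_eq_zero hf hg).resolve_right jg
  have Bh := (Quadratic.polar_eq_zero_or_jac_eq_zero hf hh).resolve_right jh
  refine ⟨hg0, hh0, Bg, Bh, ?_⟩
  have hj : f.jac (g.jac h) = ⟨0, 0, 0⟩ := by
    have := Quadratic.jac_jac f g h
    rw [Bg, Bh] at this
    simp only [zero_mul, sub_self] at this
    exact Quadratic.ext this.1 this.2.1 this.2.2
  have hJ := (Quadratic.eval_root_eq_zero_iff (g := g.jac h) hf hi hθ).2 hj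
  have e1 : (h.disc : ℂ) * G ^ 2 - 2 * Quadratic.polar g h * G * K + g.disc * K ^ 2 = 0 := by
    have : (h.disc : ℂ) * G ^ 2 - 2 * Quadratic.polar g h * G * K + g.disc * K ^ 2 =
        (((g.jac h).a : ℂ) * θ ^ 2 + (g.jac h).b * θ + (g.jac h).c) ^ 2 := by
      simp only [hG, hK, Quadratic.disc, Quadratic.polar, Quadratic.jac]
      push_cast
      ring
    rw [this, hJ]
    ring
  have e2 : 4 * ((Quadratic.polar g h : ℂ) * (G * K)) = 0 := by linear_combination e0 - 3 * e1
  simpa [hGz, hKz, jg, jh] using e2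

/-- Mutually orthogonal primitive forms are, up to the sign of `h`, an orthogonal frame. -/
theorem exists_isFrame {f g h : Quadratic} (hf : f.IsPosDef) (pf : f.IsPrimitive)
    (pg : g.IsPrimitive) (ph : h.IsPrimitive) (g0 : g ≠ ⟨0, 0, 0⟩)
    (fg : Quadratic.polar f g = 0) (fh : Quadratic.polar f h = 0) (gh : Quadratic.polar g h = 0) :
    ∃ k k' l : ℕ, IsFrame k k' l f g h ∨ IsFrame k k' l f g (Quadratic.smul (-1) h) := by
  have zero : ∀ u v w : Quadratic, Quadratic.polar u v = 0 → Quadratic.polar u w = 0 →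
      u.jac (v.jac w) = ⟨0, 0, 0⟩ := by
    intro u v w h1 h2
    have := Quadratic.jac_jac u v w
    rw [h1, h2] at this
    simp only [zero_mul, sub_self] at this
    exact Quadratic.ext this.1 this.2.1 this.2.2
  have gf := (Quadratic.polar_comm g f).trans fg
  have hf' := (Quadratic.polar_comm h f).trans fh
  have hg := (Quadratic.polar_comm h g).trans gh
  obtain ⟨k, hk⟩ := ph.eq_smul (zero h f g hf' hg)
  obtain ⟨k', hk'⟩ := pg.eq_smul (zero g h f gh gf)
  obtain ⟨l, hl⟩ := pf.eq_smul (zero f g h fg fh)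
  have ne : ∃ x : ℤ, x ≠ 0 ∧ (x = g.a ∨ x = g.b ∨ x = g.c) := by
    by_contra hn
    push Not at hn
    exact g0 (Quadratic.ext (by_contra fun h => (hn _ h).1 rfl)
      (by_contra fun h => (hn _ h).2.1 rfl) (by_contra fun h => (hn _ h).2.2 rfl))
  have dg := Quadratic.disc_pos_of_polar_eq_zero hf g0 fg
  have df := hf.disc_neg
  have kk' : k * k' = -f.disc := by
    have e := Quadratic.jac_jac f f g
    rw [hk, Quadratic.jac_smul, Quadratic.jac_anticomm f h, hk', fg, Quadratic.polar_self] at e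
    simp only [Quadratic.smul_a, Quadratic.smul_b, Quadratic.smul_c] at e
    obtain ⟨x, hx, h1⟩ := ne
    apply mul_right_cancel₀ hx
    rcases h1 with rfl | rfl | rfl
    · linear_combination -e.1
    · linear_combination -e.2.1
    · linear_combination -e.2.2
  have kl : k * l = -g.disc := by
    have e := (Quadratic.jac_jac g f g).1
    rw [hk, Quadratic.jac_smul, hl, gf, Quadratic.polar_self] at e
    simp only [Quadratic.smul_a] at e
    apply mul_right_cancel₀ hf.a_pos.ne'
    linear_combination e
  have k'l : k' * l = -h.disc := by
    have e := (Quadratic.jac_jac h h f).1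
    rw [hk', Quadratic.jac_smul, Quadratic.jac_anticomm h g, hl, hf', Quadratic.polar_self] at e
    simp only [Quadratic.smul_a] at e
    apply mul_right_cancel₀ hf.a_pos.ne'
    linear_combination -e
  have dh : (Quadratic.smul (-1) h).disc = h.disc := by
    simp only [Quadratic.disc, Quadratic.smul]; ring
  rcases lt_trichotomy k 0 with k0 | k0 | k0
  · have h1 : k' < 0 := by nlinarith
    have h2 : 0 < l := by nlinarith
    refine ⟨k.natAbs, k'.natAbs, l.natAbs,
      Or.inr ⟨by omega, by omega, by omega, hf.a_pos, ?_, ?_, ?_, ?_, ?_, ?_⟩⟩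
    · rw [hk, Int.ofNat_natAbs_of_nonpos k0.le]; simp [Quadratic.smul]
    · rw [Quadratic.jac_anticomm, Quadratic.jac_smul, Quadratic.jac_anticomm f h, hk',
        Int.ofNat_natAbs_of_nonpos h1.le]
      simp [Quadratic.smul]
    · rw [Quadratic.jac_smul, hl, Int.natAbs_of_nonneg h2.le]; simp [Quadratic.smul]
    · rw [Int.ofNat_natAbs_of_nonpos k0.le, Int.ofNat_natAbs_of_nonpos h1.le]; linarith
    · rw [Int.ofNat_natAbs_of_nonpos k0.le, Int.natAbs_of_nonneg h2.le]; linarith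
    · rw [Int.ofNat_natAbs_of_nonpos h1.le, Int.natAbs_of_nonneg h2.le, dh]; linarith
  · rw [k0, zero_mul] at kk'
    omega
  · have h1 : 0 < k' := by nlinarith
    have h2 : l < 0 := by nlinarith
    refine ⟨k.natAbs, k'.natAbs, l.natAbs,
      Or.inl ⟨by omega, by omega, by omega, hf.a_pos, ?_, ?_, ?_, ?_, ?_, ?_⟩⟩
    · rw [hk, Int.natAbs_of_nonneg k0.le]
    · rw [hk', Int.natAbs_of_nonneg h1.le]
    · rw [hl, Int.ofNat_natAbs_of_nonpos h2.le, neg_neg]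
    · rw [Int.natAbs_of_nonneg k0.le, Int.natAbs_of_nonneg h1.le]; linarith
    · rw [Int.natAbs_of_nonneg k0.le, Int.ofNat_natAbs_of_nonpos h2.le]; linarith
    · rw [Int.natAbs_of_nonneg h1.le, Int.ofNat_natAbs_of_nonpos h2.le]; linarith

/-- A form reducible of Type 2 is an integral multiple of the product of two members of a frame. -/
theorem exists_frame_of_isType2 {f : Quadratic} {F : Quartic} (pf : f.IsPrimitive)
    (hf : f.IsPosDef) (hd : SqDvdHessian f F) (ht : IsType2 f F) :
    ∃ (n : ℤ) (k k' l : ℕ) (g h : Quadratic), n ≠ 0 ∧ IsFrame k k' l f g h ∧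
      F = Quartic.smul n (Quartic.prod g h) := by
  obtain ⟨g₀, h₀, m, hm, hgh, hg, hh, hF⟩ := ht
  have hF := exists_smul_eq_smul_prod hF
  obtain ⟨g0, h0, fg, fh, gh⟩ :=
    orthogonal_of_isType2 hf hd (Rat.num_ne_zero.2 hm) hF hgh hg hh
  obtain ⟨c, g, hc, pg, rfl⟩ := g₀.exists_primitive g0
  obtain ⟨d, h, hd0, ph, rfl⟩ := h₀.exists_primitive h0
  have g1 : g ≠ ⟨0, 0, 0⟩ := by
    rintro rfl
    simp [Quadratic.smul] at g0
  have ps : ∀ (c : ℤ) (u v : Quadratic), c ≠ 0 → Quadratic.polar u (Quadratic.smul c v) = 0 →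
      Quadratic.polar u v = 0 := by
    intro c u v hc e
    have : c * Quadratic.polar u v = 0 := by
      rw [← e]; simp only [Quadratic.polar, Quadratic.smul]; ring
    exact (mul_eq_zero.1 this).resolve_left hc
  have fg := ps c _ _ hc fg
  have fh := ps d _ _ hd0 fh
  have gh := ps d _ _ hd0 gh
  rw [Quadratic.polar_comm] at gh
  have gh := ps c _ _ hc gh
  rw [Quadratic.polar_comm] at gh
  -- the multiplier with respect to the primitive forms, in lowest terms
  set r : ℚ := m * c * d with hr
  have hr0 : r ≠ 0 := by
    have : (c : ℚ) ≠ 0 := by exact_mod_cast hc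
    have : (d : ℚ) ≠ 0 := by exact_mod_cast hd0
    positivity
  have hF' : Quartic.smul r.den F = Quartic.smul r.num (Quartic.prod g h) := by
    have key : ∀ x y z : ℤ, m.den * x = m.num * y → y = c * d * z → r.den * x = r.num * z := by
      intro x y z e1 e2
      have e3 : (x : ℚ) = m * y := by
        have : (m.den : ℚ) * x = m.num * y := by exact_mod_cast e1
        rw [← Rat.mul_den_eq_num m] at this
        have hden : (m.den : ℚ) ≠ 0 := by exact_mod_cast m.den_ne_zero
        apply mul_left_cancel₀ hden
        rw [this]; ring
      have e4 : (r.den : ℚ) * x = r.num * z := by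
        rw [← Rat.mul_den_eq_num r, e3, e2, hr]
        push_cast
        ring
      exact_mod_cast e4
    simp only [Quartic.smul, Quartic.prod, Quadratic.smul, Quartic.mk.injEq] at hF ⊢
    exact ⟨key _ _ _ hF.1 (by ring), key _ _ _ hF.2.1 (by ring), key _ _ _ hF.2.2.1 (by ring),
      key _ _ _ hF.2.2.2.1 (by ring), key _ _ _ hF.2.2.2.2 (by ring)⟩
  have hu := Quartic.isUnit_denominator_of_primitive pg ph
    (Int.isCoprime_iff_gcd_eq_one.2 (by simpa [Int.gcd] using r.reduced)) hF'
  have hden : (r.den : ℤ) = 1 := by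
    rcases Int.isUnit_iff.1 hu with h | h
    · exact h
    · have := r.den_pos; omega
  rw [hden] at hF'
  have hF1 : F = Quartic.smul r.num (Quartic.prod g h) := by
    rw [← hF']; simp [Quartic.smul]
  obtain ⟨k, k', l, H | H⟩ := exists_isFrame hf pf pg ph g1 fg fh gh
  · exact ⟨r.num, k, k', l, g, h, Rat.num_ne_zero.2 hr0, H, hF1⟩
  · refine ⟨-r.num, k, k', l, g, Quadratic.smul (-1) h,
      neg_ne_zero.2 (Rat.num_ne_zero.2 hr0), H, ?_⟩
    rw [hF1]
    simp only [Quartic.smul, Quartic.prod, Quadratic.smul, Quartic.mk.injEq]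
    refine ⟨by ring, by ring, by ring, by ring, by ring⟩

theorem IsFrame.polar_gh {k k' l : ℕ} {f g h : Quadratic} (H : IsFrame k k' l f g h) :
    Quadratic.polar g h = 0 := by
  have : (k : ℤ) * Quadratic.polar g h = 0 := by
    have e : Quadratic.polar g (Quadratic.smul k h) = 0 := by
      rw [← H.jac_fg]; simp only [Quadratic.polar, Quadratic.jac]; ring
    rw [← e]; simp only [Quadratic.polar, Quadratic.smul]; ring
  exact (mul_eq_zero.1 this).resolve_left (by exact_mod_cast H.k_pos.ne')

theorem IsFrame.four_I {k k' l : ℕ} {f g h : Quadratic} (H : IsFrame k k' l f g h) (n : ℤ) :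
    4 * (Quartic.smul n (Quartic.prod g h)).I = 3 * n ^ 2 * k * k' * l ^ 2 := by
  rw [Quartic.four_I_smul_prod, H.polar_gh, H.disc_g, H.disc_h]
  ring

/-! ### Classification of frames with given multiples -/

namespace IsFrame

variable {k k' l : ℕ} {f g h : Quadratic}

/-- Frames are preserved by `SL₂(ℤ)`. -/
theorem act (H : IsFrame k k' l f g h) {T : Matrix (Fin 2) (Fin 2) ℤ} (hT : T.det = 1) :
    IsFrame k k' l (f.act T) (g.act T) (h.act T) := by
  rw [Matrix.det_fin_two] at hT
  have hjac : ∀ u v : Quadratic, (u.act T).jac (v.act T) = (u.jac v).act T := by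
    intro u v
    have : (u.act T).jac (v.act T) =
        Quadratic.smul (T 0 0 * T 1 1 - T 0 1 * T 1 0) ((u.jac v).act T) := by
      simp only [Quadratic.act, Quadratic.jac, Quadratic.smul, Quadratic.mk.injEq]
      refine ⟨by ring, by ring, by ring⟩
    rw [this, hT]
    simp [Quadratic.smul]
  have hsmul : ∀ (c : ℤ) (u : Quadratic), (Quadratic.smul c u).act T =
      Quadratic.smul c (u.act T) := by
    intro c u
    simp only [Quadratic.act, Quadratic.smul, Quadratic.mk.injEq]
    refine ⟨by ring, by ring, by ring⟩
  have hdisc : ∀ u : Quadratic, (u.act T).disc = u.disc := by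
    intro u
    have : (u.act T).disc = (T 0 0 * T 1 1 - T 0 1 * T 1 0) ^ 2 * u.disc := by
      simp only [Quadratic.act, Quadratic.disc]
      ring
    rw [this, hT]
    ring
  refine ⟨H.k_pos, H.k'_pos, H.l_pos, ?_, ?_, ?_, ?_, ?_, ?_, ?_⟩
  · -- `4 f.a f(x, y) = (2 f.a x + f.b y)² + k k' y²`
    have e : 4 * f.a * (f.act T).a = (2 * f.a * T 0 0 + f.b * T 1 0) ^ 2
        + (k * k') * T 1 0 ^ 2 := by
      have := H.disc_f
      simp only [Quadratic.disc] at this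
      simp only [Quadratic.act]
      linear_combination (-T 1 0 ^ 2) * this
    have hk : (0 : ℤ) < k * k' := by
      have h1 := H.k_pos
      have h2 := H.k'_pos
      positivity
    have ha := H.a_pos
    have : 0 < 4 * f.a * (f.act T).a := by
      rw [e]
      by_cases h10 : T 1 0 = 0
      · have h00 : T 0 0 ≠ 0 := by
          rintro h00
          simp [h00, h10] at hT
        rw [h10]
        have : 2 * f.a * T 0 0 ≠ 0 := by positivity
        simp only [mul_zero, add_zero, ne_eq, OfNat.ofNat_ne_zero, not_false_eq_true, zero_pow]
        positivity
      · positivity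
    exact pos_of_mul_pos_right this (by positivity)
  · rw [hjac, H.jac_fg, hsmul]
  · rw [hjac, H.jac_hf, hsmul]
  · rw [hjac, H.jac_gh, hsmul]
  · rw [hdisc, H.disc_f]
  · rw [hdisc, H.disc_g]
  · rw [hdisc, H.disc_h]

/-- The syzygy `l f² = k' g² + k h²` at the point `(1, 0)`. -/
theorem conic (H : IsFrame k k' l f g h) :
    (l : ℤ) * f.a ^ 2 = k' * g.a ^ 2 + k * h.a ^ 2 := by
  have h1 := congrArg Quadratic.a H.jac_fg
  have h2 := congrArg Quadratic.a H.jac_hf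
  have h3 := congrArg Quadratic.a H.jac_gh
  simp only [Quadratic.jac, Quadratic.smul_a] at h1 h2 h3
  linear_combination h.a * h1 + g.a * h2 + f.a * h3

/-- A frame is determined by its first two rows of coefficients. -/
theorem ext {f' g' h' : Quadratic} (H : IsFrame k k' l f g h) (H' : IsFrame k k' l f' g' h')
    (fa : f.a = f'.a) (ga : g.a = g'.a) (ha : h.a = h'.a) (fb : f.b = f'.b) (gb : g.b = g'.b)
    (hb : h.b = h'.b) : f = f' ∧ g = g' ∧ h = h' := by
  have a0 := H.a_pos.ne'
  have d := H.disc_f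
  have d' := H'.disc_f
  have h1 := congrArg Quadratic.b H.jac_fg
  have h1' := congrArg Quadratic.b H'.jac_fg
  have h2 := congrArg Quadratic.b H.jac_hf
  have h2' := congrArg Quadratic.b H'.jac_hf
  simp only [Quadratic.disc, Quadratic.jac, Quadratic.smul_b] at d d' h1 h1' h2 h2'
  rw [← fa, ← fb] at d'
  have fc : f.c = f'.c := by
    apply mul_left_cancel₀ a0
    linarith
  rw [← fa, ← ga, ← hb, ← fc] at h1'
  rw [← fa, ← ha, ← gb, ← fc] at h2'
  have gc : g.c = g'.c := by
    apply mul_left_cancel₀ a0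
    linarith
  have hc : h.c = h'.c := by
    apply mul_left_cancel₀ a0
    linarith
  exact ⟨Quadratic.ext fa fb fc, Quadratic.ext ga gb gc, Quadratic.ext ha hb hc⟩

end IsFrame

/-- A coprime vector is the first column of a matrix of determinant one. -/
theorem exists_det_eq_one {x y : ℤ} (h : IsCoprime x y) :
    ∃ T : Matrix (Fin 2) (Fin 2) ℤ, T.det = 1 ∧ T 0 0 = x ∧ T 1 0 = y := by
  obtain ⟨r, s, e⟩ := h
  refine ⟨!![x, -s; y, r], ?_, rfl, rfl⟩
  rw [Matrix.det_fin_two_of]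
  linear_combination e

/-- The binary quadratic form `A x² + 2 B x y + C y²` with `B² = A C` is, up to a constant, the
square of a linear form; the zero of that form is written as a multiple of a primitive vector. -/
theorem exists_null_vector {A B C : ℤ} (h : B ^ 2 = A * C) (h0 : A ≠ 0 ∨ C ≠ 0) :
    ∃ x y c m : ℤ, IsCoprime x y ∧ c ≠ 0 ∧ c * A = m * y ^ 2 ∧ c * B = -(m * x * y) ∧
      c * C = m * x ^ 2 := by
  obtain ⟨u, v, c, huv, hc, e1, e2, e3⟩ : ∃ u v c : ℤ, (u ≠ 0 ∨ v ≠ 0) ∧ c ≠ 0 ∧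
      c * A = v ^ 2 ∧ c * B = -(u * v) ∧ c * C = u ^ 2 := by
    by_cases hA : A = 0
    · have hB : B = 0 := by simpa [hA] using h
      have hC : C ≠ 0 := h0.resolve_left (by simp [hA])
      exact ⟨C, 0, C, Or.inl hC, hC, by simp [hA], by simp [hB], by ring⟩
    · exact ⟨-B, A, A, Or.inr hA, hA, by ring, by ring, by rw [neg_sq, h]⟩
  have hg : 0 < Int.gcd u v := Int.gcd_pos_iff.2 huv
  obtain ⟨d, x, y, -, hxy, rfl, rfl⟩ := Int.exists_gcd_one' hg
  exact ⟨x, y, c, (d : ℤ) ^ 2, Int.isCoprime_iff_gcd_eq_one.2 hxy, hc, by rw [e1]; ring,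
    by rw [e2]; ring, by rw [e3]; ring⟩

namespace IsFrame

variable {k k' l : ℕ} {f g h : Quadratic}

/-- Every primitive integral point `(p, q, r)` of the conic `l p² = k' q² + k r²` is, up to a
positive factor `δ`, the value of the frame at a primitive vector, which can be moved to `(1, 0)`.
The vector is the double root of the form `-l p f + k' q g + k r h` of discriminant zero. -/
theorem exists_normalized (H : IsFrame k k' l f g h) {p q r x y z : ℤ} (hp : 0 < p)
    (hprim : x * p + y * q + z * r = 1) (hpt : (l : ℤ) * p ^ 2 = k' * q ^ 2 + k * r ^ 2) :
    ∃ T : Matrix (Fin 2) (Fin 2) ℤ, T.det = 1 ∧ ∃ δ : ℕ, 0 < δ ∧ (f.act T).a = δ * p ∧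
      (g.act T).a = δ * q ∧ (h.act T).a = δ * r := by
  have fg : Quadratic.polar f g = 0 := by
    have : (k' : ℤ) * Quadratic.polar f g = 0 := by
      have e : Quadratic.polar f (Quadratic.smul k' g) = 0 := by
        rw [← H.jac_hf]; simp only [Quadratic.polar, Quadratic.jac]; ring
      rw [← e]; simp only [Quadratic.polar, Quadratic.smul]; ring
    exact (mul_eq_zero.1 this).resolve_left (by exact_mod_cast H.k'_pos.ne')
  have fh : Quadratic.polar f h = 0 := by
    have : (k : ℤ) * Quadratic.polar f h = 0 := by
      have e : Quadratic.polar f (Quadratic.smul k h) = 0 := by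
        rw [← H.jac_fg]; simp only [Quadratic.polar, Quadratic.jac]; ring
      rw [← e]; simp only [Quadratic.polar, Quadratic.smul]; ring
    exact (mul_eq_zero.1 this).resolve_left (by exact_mod_cast H.k_pos.ne')
  have gh := H.polar_gh
  have df := H.disc_f
  have dg := H.disc_g
  have dh := H.disc_h
  have kpos : (k : ℤ) ≠ 0 := by exact_mod_cast H.k_pos.ne'
  have k'pos : (k' : ℤ) ≠ 0 := by exact_mod_cast H.k'_pos.ne'
  have lpos : (l : ℤ) ≠ 0 := by exact_mod_cast H.l_pos.ne'
  -- twice the form `-l p f + k' q g + k r h` is `A x² + 2 B x y + E y²`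
  set A := 2 * (-(l * p * f.a) + k' * q * g.a + k * r * h.a) with hA
  set B := -(l * p * f.b) + k' * q * g.b + k * r * h.b with hB
  set E := 2 * (-(l * p * f.c) + k' * q * g.c + k * r * h.c) with hE
  simp only [Quadratic.polar, Quadratic.disc] at fg fh gh df dg dh
  have hdisc : B ^ 2 = A * E := by
    rw [hA, hB, hE]
    linear_combination (l * p) ^ 2 * df + (k' * q) ^ 2 * dg + (k * r) ^ 2 * dh
      - 2 * (l * p) * (k' * q) * fg - 2 * (l * p) * (k * r) * fh + 2 * (k' * q) * (k * r) * gh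
      - k * k' * l * hpt
  have pf : f.b * B - f.a * E - f.c * A = l * k * k' * p := by
    rw [hA, hB, hE]
    linear_combination (-(l * p)) * df + (k' * q) * fg + (k * r) * fh
  have pg : g.b * B - g.a * E - g.c * A = l * k * k' * q := by
    rw [hA, hB, hE]
    linear_combination (k' * q) * dg - (l * p) * fg + (k * r) * gh
  have ph : h.b * B - h.a * E - h.c * A = l * k * k' * r := by
    rw [hA, hB, hE]
    linear_combination (k * r) * dh - (l * p) * fh + (k' * q) * gh
  have hne : A ≠ 0 ∨ E ≠ 0 := by
    by_contra hn
    push Not at hn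
    have hB0 : B = 0 := by rw [hn.1, zero_mul] at hdisc; simpa using hdisc
    rw [hn.1, hn.2, hB0] at pf
    have : (l : ℤ) * k * k' * p ≠ 0 := by positivity
    apply this
    rw [← pf]; ring
  obtain ⟨u, v, c, m, huv, hc, e1, e2, e3⟩ := exists_null_vector hdisc hne
  obtain ⟨T, hT, h00, h10⟩ := exists_det_eq_one huv
  refine ⟨T, hT, ?_⟩
  have hf : -m * (f.act T).a = c * (l * k * k') * p := by
    simp only [Quadratic.act, h00, h10]
    linear_combination c * pf - f.b * e2 + f.a * e3 + f.c * e1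
  have hg : -m * (g.act T).a = c * (l * k * k') * q := by
    simp only [Quadratic.act, h00, h10]
    linear_combination c * pg - g.b * e2 + g.a * e3 + g.c * e1
  have hh : -m * (h.act T).a = c * (l * k * k') * r := by
    simp only [Quadratic.act, h00, h10]
    linear_combination c * ph - h.b * e2 + h.a * e3 + h.c * e1
  have fpos := (H.act hT).a_pos
  set a₁ := (f.act T).a
  set a₂ := (g.act T).a
  set a₃ := (h.act T).a
  have hm : -m ≠ 0 := by
    intro hm
    rw [hm, zero_mul] at hf
    have : c * (l * k * k') * p ≠ 0 := by positivity
    exact this hf.symm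
  have r1 : a₁ * q = a₂ * p := by
    apply mul_left_cancel₀ hm
    linear_combination q * hf - p * hg
  have r2 : a₁ * r = a₃ * p := by
    apply mul_left_cancel₀ hm
    linear_combination r * hf - p * hh
  have s1 : a₁ = (x * a₁ + y * a₂ + z * a₃) * p := by
    linear_combination (-a₁) * hprim + y * r1 + z * r2
  have hδ : 0 < x * a₁ + y * a₂ + z * a₃ := by
    by_contra hn
    push Not at hn
    have := mul_nonpos_of_nonpos_of_nonneg hn hp.le
    omega
  refine ⟨(x * a₁ + y * a₂ + z * a₃).toNat, by omega, ?_⟩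
  rw [Int.toNat_of_nonneg hδ.le]
  refine ⟨s1, ?_, ?_⟩
  · apply mul_right_cancel₀ hp.ne'
    linear_combination -r1 + q * s1
  · apply mul_right_cancel₀ hp.ne'
    linear_combination -r2 + r * s1

end IsFrame

theorem Quartic.smul_prod_equiv_act (n : ℤ) (g h : Quadratic) {T : Matrix (Fin 2) (Fin 2) ℤ}
    (hT : T.det = 1) : (Quartic.smul n (Quartic.prod g h)) ≈
      Quartic.smul n (Quartic.prod (g.act T) (h.act T)) := by
  refine ⟨Matrix.GeneralLinearGroup.mk'' T (by rw [hT]; exact isUnit_one), ?_⟩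
  rw [Quartic.smul_prod_toPoly, Quartic.smul_prod_toPoly, ← Quadratic.subst_toPoly,
    ← Quadratic.subst_toPoly, map_mul, map_mul]
  congr 2
  exact ((subst T).commutes n).symm

namespace IsFrame

variable {k k' l : ℕ} {f g h f' g' h' : Quadratic}

/-- Divisibilities for a frame with first row `δ (p, q, r)`. -/
theorem dvd_of_normalized (H : IsFrame k k' l f g h) {p q r δ : ℤ} (fa : f.a = δ * p)
    (ga : g.a = δ * q) (ha : h.a = δ * r) :
    2 * δ ∣ l * f.b ∧ 2 * δ ∣ k' * g.b ∧ 2 * δ ∣ k * h.b ∧ δ ∣ k * k' * l := by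
  have h1 := congrArg Quadratic.b H.jac_fg
  have h2 := congrArg Quadratic.b H.jac_hf
  have h3 := congrArg Quadratic.b H.jac_gh
  simp only [Quadratic.jac, Quadratic.smul_b, fa, ga, ha] at h1 h2 h3
  have hk : 2 * δ ∣ k * h.b := ⟨p * g.c - q * f.c, by linear_combination -h1⟩
  refine ⟨⟨-(q * h.c - r * g.c), by linear_combination h3⟩,
    ⟨r * f.c - p * h.c, by linear_combination -h2⟩, hk, ?_⟩
  have d := H.disc_h
  rw [Quadratic.disc, ha] at d
  obtain ⟨w, hw⟩ := hk
  exact ⟨2 * w * h.b - 4 * k * r * h.c, by linear_combination h.b * hw - k * d⟩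

/-- Two frames with the same first row `δ (p, q, r)` differ by a translation `x ↦ x + w y`, provided
that a suitable combination of their middle rows agrees modulo `2 δ ρ`,
`ρ = gcd (l p, k' q, k r)`. Indeed the middle rows differ by `t (p, q, r)` for some `t`, and the
divisibilities above make `ρ t` a multiple of `2 δ`. -/
theorem equiv_of_normalized (H : IsFrame k k' l f g h) (H' : IsFrame k k' l f' g' h')
    {p q r x y z δ ρ X Y Z w w' : ℤ} (hp : 0 < p) (hδ : 0 < δ) (hρ0 : ρ ≠ 0)
    (hprim : x * p + y * q + z * r = 1) (hρ : X * (l * p) + Y * (k' * q) + Z * (k * r) = ρ)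
    (fa : f.a = δ * p) (ga : g.a = δ * q) (ha : h.a = δ * r)
    (fa' : f'.a = δ * p) (ga' : g'.a = δ * q) (ha' : h'.a = δ * r)
    (hw : X * (l * f.b) + Y * (k' * g.b) + Z * (k * h.b) = 2 * δ * w)
    (hw' : X * (l * f'.b) + Y * (k' * g'.b) + Z * (k * h'.b) = 2 * δ * w')
    (hww : ρ ∣ w' - w) (n : ℤ) :
    Quartic.smul n (Quartic.prod g h) ≈ Quartic.smul n (Quartic.prod g' h') := by
  have h1 := congrArg Quadratic.a H.jac_fg
  have h2 := congrArg Quadratic.a H.jac_hf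
  have h1' := congrArg Quadratic.a H'.jac_fg
  have h2' := congrArg Quadratic.a H'.jac_hf
  simp only [Quadratic.jac, Quadratic.smul_a, fa, ga, ha, fa', ga', ha'] at h1 h2 h1' h2'
  set t := x * (f'.b - f.b) + y * (g'.b - g.b) + z * (h'.b - h.b) with ht
  have d1 : p * (g'.b - g.b) = q * (f'.b - f.b) := by
    apply mul_left_cancel₀ hδ.ne'
    linear_combination h1' - h1
  have d2 : p * (h'.b - h.b) = r * (f'.b - f.b) := by
    apply mul_left_cancel₀ hδ.ne'
    linear_combination h2 - h2'
  have tf : f'.b = f.b + t * p := by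
    rw [ht]; linear_combination -y * d1 - z * d2 - (f'.b - f.b) * hprim
  have tg : g'.b = g.b + t * q := by
    apply mul_left_cancel₀ hp.ne'
    linear_combination d1 + q * tf
  have th : h'.b = h.b + t * r := by
    apply mul_left_cancel₀ hp.ne'
    linear_combination d2 + r * tf
  obtain ⟨c, hc⟩ := hww
  have htc : t = 2 * δ * c := by
    apply mul_left_cancel₀ hρ0
    rw [tf, tg, th] at hw'
    linear_combination hw' - hw + 2 * δ * hc - t * hρ
  have hT : Matrix.det !![1, c; 0, (1 : ℤ)] = 1 := by simp [Matrix.det_fin_two_of]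
  have e := (H.act hT).ext H' (by simp [Quadratic.act, fa, fa']) (by simp [Quadratic.act, ga, ga'])
    (by simp [Quadratic.act, ha, ha']) (by simp [Quadratic.act, fa, tf, htc]; ring)
    (by simp [Quadratic.act, ga, tg, htc]; ring) (by simp [Quadratic.act, ha, th, htc]; ring)
  rw [← e.2.1, ← e.2.2]
  exact Quartic.smul_prod_equiv_act n g h hT

end IsFrame

/-- If `(p, q, r)` is a primitive point of `l p² = k' q² + k r²`, the square of a common divisor
of `l p, k' q, k r` divides `k k' l`. -/
theorem sq_dvd_of_conic {k k' l p q r x y z ρ : ℤ}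
    (hprim : x * p + y * q + z * r = 1) (hpt : l * p ^ 2 = k' * q ^ 2 + k * r ^ 2)
    (h1 : ρ ∣ l * p) (h2 : ρ ∣ k' * q) (h3 : ρ ∣ k * r) : ρ ^ 2 ∣ k * k' * l := by
  obtain ⟨a, ha⟩ := h1
  obtain ⟨b, hb⟩ := h2
  obtain ⟨c, hc⟩ := h3
  -- `k k' l` times any product of two coordinates is divisible by `ρ ^ 2`
  have pp : k * k' * l * p ^ 2 = ρ ^ 2 * (k * b ^ 2 + k' * c ^ 2) := by
    linear_combination k * k' * hpt + k * (k' * q + ρ * b) * hb + k' * (k * r + ρ * c) * hc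
  have qq : k * k' * l * q ^ 2 = ρ ^ 2 * (k * a ^ 2 - l * c ^ 2) := by
    linear_combination (-k * l) * hpt + k * (l * p + ρ * a) * ha - l * (k * r + ρ * c) * hc
  have rr : k * k' * l * r ^ 2 = ρ ^ 2 * (k' * a ^ 2 - l * b ^ 2) := by
    linear_combination (-k' * l) * hpt + k' * (l * p + ρ * a) * ha - l * (k' * q + ρ * b) * hb
  have pq : k * k' * l * (p * q) = ρ ^ 2 * (k * a * b) := by
    linear_combination k * k' * q * ha + k * ρ * a * hb
  have pr : k * k' * l * (p * r) = ρ ^ 2 * (k' * a * c) := by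
    linear_combination k * k' * r * ha + k' * ρ * a * hc
  have qr : k * k' * l * (q * r) = ρ ^ 2 * (l * b * c) := by
    linear_combination k * l * r * hb + l * ρ * b * hc
  refine ⟨x ^ 2 * (k * b ^ 2 + k' * c ^ 2) + y ^ 2 * (k * a ^ 2 - l * c ^ 2) +
    z ^ 2 * (k' * a ^ 2 - l * b ^ 2) + 2 * x * y * (k * a * b) + 2 * x * z * (k' * a * c) +
    2 * y * z * (l * b * c), ?_⟩
  linear_combination x ^ 2 * pp + y ^ 2 * qq + z ^ 2 * rr + 2 * x * y * pq + 2 * x * z * pr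
    + 2 * y * z * qr - k * k' * l * (1 + (x * p + y * q + z * r)) * hprim

/-- Up to `SL₂(ℤ)`, the frames with multiples `k, k', l` are classified by a divisor of `k k' l`
and a residue modulo some `s` with `s² ∣ k k' l`. -/
theorem exists_frame_invariant (k k' l : ℕ) : ∃ s : ℕ, s ^ 2 ∣ k * k' * l ∧
    ∃ inv : Quadratic × Quadratic × Quadratic → ℕ × ℕ,
      (∀ f g h, IsFrame k k' l f g h → (inv (f, g, h)).1 ∣ k * k' * l ∧ (inv (f, g, h)).2 < s) ∧
      ∀ f g h f' g' h', IsFrame k k' l f g h → IsFrame k k' l f' g' h' →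
        inv (f, g, h) = inv (f', g', h') → ∀ n : ℤ,
          Quartic.smul n (Quartic.prod g h) ≈ Quartic.smul n (Quartic.prod g' h') := by
  by_cases hex : ∃ f g h, IsFrame k k' l f g h
  swap
  · refine ⟨1, by simp, fun _ => (1, 0), ?_, ?_⟩
    · exact fun f g h H => (hex ⟨f, g, h, H⟩).elim
    · exact fun f g h _ _ _ H => (hex ⟨f, g, h, H⟩).elim
  -- a primitive point of the conic, taken from some frame
  obtain ⟨p, q, r, x, y, z, hp, hprim, hpt⟩ : ∃ p q r x y z : ℤ, 0 < p ∧
      x * p + y * q + z * r = 1 ∧ (l : ℤ) * p ^ 2 = k' * q ^ 2 + k * r ^ 2 := by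
    obtain ⟨f, g, h, H⟩ := hex
    have a0 := H.a_pos
    obtain ⟨c, P, hc, hP, e⟩ := Quadratic.exists_primitive ⟨f.a, g.a, h.a⟩
      (by intro e; simp only [Quadratic.mk.injEq] at e; omega)
    have hcon := H.conic
    simp only [Quadratic.smul, Quadratic.mk.injEq] at e
    rw [e.1, e.2.1, e.2.2] at hcon
    have hpt : (l : ℤ) * P.a ^ 2 = k' * P.b ^ 2 + k * P.c ^ 2 := by
      apply mul_left_cancel₀ (pow_ne_zero 2 hc)
      linear_combination hcon
    obtain ⟨x, y, z, hxyz⟩ := hP.bezout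
    have hPa : P.a ≠ 0 := by
      intro h0
      rw [h0, mul_zero] at e
      omega
    rcases lt_or_gt_of_ne hPa with h0 | h0
    · exact ⟨-P.a, P.b, P.c, -x, y, z, by omega, by linear_combination hxyz,
        by linear_combination hpt⟩
    · exact ⟨P.a, P.b, P.c, x, y, z, h0, hxyz, hpt⟩
  obtain ⟨f₀, g₀, h₀, H₀⟩ := hex
  have kpos : (0 : ℤ) < k := by exact_mod_cast H₀.k_pos
  have k'pos : (0 : ℤ) < k' := by exact_mod_cast H₀.k'_pos
  have lpos : (0 : ℤ) < l := by exact_mod_cast H₀.l_pos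
  -- the greatest common divisor `ρ` of `l p, k' q, k r`
  obtain ⟨c, P, hc, hP, e⟩ := Quadratic.exists_primitive ⟨l * p, k' * q, k * r⟩
    (by
      intro e
      simp only [Quadratic.mk.injEq] at e
      have : (l : ℤ) * p ≠ 0 := by positivity
      exact this e.1)
  simp only [Quadratic.smul, Quadratic.mk.injEq] at e
  obtain ⟨X, Y, Z, hXYZ⟩ := hP.bezout
  have hρ : X * (l * p) + Y * (k' * q) + Z * (k * r) = c := by
    rw [e.1, e.2.1, e.2.2]; linear_combination c * hXYZ
  have hs := sq_dvd_of_conic hprim hpt (ρ := c) ⟨_, e.1⟩ ⟨_, e.2.1⟩ ⟨_, e.2.2⟩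
  have hc0 : 0 < c.natAbs := Int.natAbs_pos.2 hc
  have choice : ∀ Φ : Quadratic × Quadratic × Quadratic, ∃ i : ℕ × ℕ,
      IsFrame k k' l Φ.1 Φ.2.1 Φ.2.2 → i.1 ∣ k * k' * l ∧ i.2 < c.natAbs ∧ 0 < i.1 ∧
        ∃ (T : Matrix (Fin 2) (Fin 2) ℤ) (w : ℤ), T.det = 1 ∧ (Φ.1.act T).a = i.1 * p ∧
          (Φ.2.1.act T).a = i.1 * q ∧ (Φ.2.2.act T).a = i.1 * r ∧
          X * (l * (Φ.1.act T).b) + Y * (k' * (Φ.2.1.act T).b) + Z * (k * (Φ.2.2.act T).b) =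
            2 * i.1 * w ∧ w % c = i.2 := by
    rintro ⟨f, g, h⟩
    by_cases H : IsFrame k k' l f g h
    swap
    · exact ⟨(0, 0), fun H' => (H H').elim⟩
    obtain ⟨T, hT, δ, hδ, fa, ga, ha⟩ := H.exists_normalized hp hprim hpt
    obtain ⟨⟨u, hu⟩, ⟨v, hv⟩, ⟨w, hw⟩, hd⟩ := (H.act hT).dvd_of_normalized fa ga ha
    have hmod := Int.emod_nonneg (X * u + Y * v + Z * w) hc
    have hlt := Int.emod_lt (X * u + Y * v + Z * w) hc
    refine ⟨(δ, ((X * u + Y * v + Z * w) % c).toNat), fun _ => ⟨by exact_mod_cast hd, ?_, hδ,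
      T, X * u + Y * v + Z * w, hT, fa, ga, ha, ?_, ?_⟩⟩
    · simp only
      omega
    · simp only [hu, hv, hw]
      ring
    · simp only
      rw [Int.toNat_of_nonneg hmod]
  choose inv hinv using choice
  refine ⟨c.natAbs, ?_, inv, fun f g h H => ⟨(hinv _ H).1, (hinv _ H).2.1⟩, ?_⟩
  · rw [← Int.natCast_dvd_natCast]
    push_cast
    rwa [sq_abs]
  · intro f g h f' g' h' H H' hi n
    obtain ⟨-, -, hδ, T, w, hT, fa, ga, ha, hw, hwm⟩ := hinv (f, g, h) H
    obtain ⟨-, -, -, T', w', hT', fa', ga', ha', hw', hwm'⟩ := hinv (f', g', h') H'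
    rw [← hi] at fa' ga' ha' hw' hwm'
    have hww : c ∣ w' - w := Int.ModEq.dvd (hwm.trans hwm'.symm)
    refine Setoid.trans (Quartic.smul_prod_equiv_act n g h hT) (Setoid.trans ?_
      (Setoid.symm (Quartic.smul_prod_equiv_act n g' h' hT')))
    exact (H.act hT).equiv_of_normalized (H'.act hT') hp (by exact_mod_cast hδ) hc hprim hρ
      fa ga ha fa' ga' ha' hw hw' hww n

/-! ### Divisor sums -/

/-- The divisor bound: the number of divisors of `m` is `O(m ^ ε)`. -/
theorem exists_card_divisors_le_rpow {ε : ℝ} (hε : 0 < ε) :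
    ∃ C : ℝ, 0 < C ∧ ∀ m : ℕ, m ≠ 0 → (m.divisors.card : ℝ) ≤ C * (m : ℝ) ^ ε := by
  -- primes `p ≥ P` satisfy `a + 1 ≤ 2 ^ a ≤ p ^ (ε a)`; the others lose a factor `D` each
  obtain ⟨P, hP⟩ : ∃ P : ℕ, (2 : ℝ) ^ (1 / ε) ≤ P := exists_nat_ge _
  set c : ℝ := ε * Real.log 2 with hc
  have hc0 : 0 < c := mul_pos hε (Real.log_pos (by norm_num))
  set D : ℝ := 1 + 1 / c with hD
  have hD1 : 1 ≤ D := by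
    have : 0 < 1 / c := by positivity
    linarith
  refine ⟨D ^ P, by positivity, fun m hm => ?_⟩
  have hlocal : ∀ p ∈ m.primeFactors, ((m.factorization p + 1 : ℕ) : ℝ) ≤
      (if p < P then D else 1) * ((p : ℝ) ^ m.factorization p) ^ ε := by
    intro p hp
    have hp2 : (2 : ℝ) ≤ p := by exact_mod_cast (Nat.prime_of_mem_primeFactors hp).two_le
    set a := m.factorization p
    have hcomm : ((p : ℝ) ^ a) ^ ε = ((p : ℝ) ^ ε) ^ a := by
      rw [← Real.rpow_natCast, ← Real.rpow_natCast, ← Real.rpow_mul (by positivity),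
        ← Real.rpow_mul (by positivity), mul_comm]
    rw [hcomm]
    split_ifs with h
    · have h1 : 1 + c ≤ (p : ℝ) ^ ε := by
        calc 1 + c ≤ Real.exp c := by linarith [Real.add_one_le_exp c]
          _ = (2 : ℝ) ^ ε := by rw [Real.rpow_def_of_pos (by norm_num), hc, mul_comm]
          _ ≤ (p : ℝ) ^ ε := Real.rpow_le_rpow (by norm_num) hp2 hε.le
      have h2 : 1 + (a : ℝ) * c ≤ ((p : ℝ) ^ ε) ^ a :=
        (one_add_mul_le_pow (by linarith) a).trans (pow_le_pow_left₀ (by linarith) h1 a)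
      have h3 : ((a + 1 : ℕ) : ℝ) ≤ D * (1 + a * c) := by
        have : D * (1 + a * c) = 1 + a + 1 / c + a * c := by rw [hD]; field_simp; ring
        rw [this]
        push_cast
        have : 0 < 1 / c := by positivity
        have : 0 ≤ (a : ℝ) * c := by positivity
        linarith
      exact h3.trans (mul_le_mul_of_nonneg_left h2 (by linarith))
    · have h1 : (2 : ℝ) ≤ (p : ℝ) ^ ε := by
        have hPp : (2 : ℝ) ^ (1 / ε) ≤ p := hP.trans (by exact_mod_cast not_lt.1 h)
        calc (2 : ℝ) = ((2 : ℝ) ^ (1 / ε)) ^ ε := by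
              rw [← Real.rpow_mul (by norm_num), one_div_mul_cancel hε.ne', Real.rpow_one]
          _ ≤ _ := Real.rpow_le_rpow (by positivity) hPp hε.le
      rw [one_mul]
      calc ((a + 1 : ℕ) : ℝ) ≤ ((2 ^ a : ℕ) : ℝ) := by
            exact_mod_cast Nat.succ_le_of_lt Nat.lt_two_pow_self
        _ = (2 : ℝ) ^ a := by push_cast; rfl
        _ ≤ _ := pow_le_pow_left₀ (by norm_num) h1 a
  have hm' : (m : ℝ) ^ ε = ∏ p ∈ m.primeFactors, ((p : ℝ) ^ m.factorization p) ^ ε := by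
    rw [Real.finsetProd_rpow _ _ (fun i _ => by positivity)]
    congr 1
    conv_lhs => rw [← Nat.prod_factorization_pow_eq_self hm]
    rw [Finsupp.prod, Nat.support_factorization]
    push_cast
    rfl
  rw [Nat.card_divisors hm, hm']
  push_cast
  calc ∏ p ∈ m.primeFactors, ((m.factorization p : ℝ) + 1)
      ≤ ∏ p ∈ m.primeFactors,
        ((if p < P then D else 1) * ((p : ℝ) ^ m.factorization p) ^ ε) :=
        Finset.prod_le_prod (fun _ _ => by positivity) fun p hp => by
          exact_mod_cast hlocal p hp
    _ = (∏ p ∈ m.primeFactors, if p < P then D else 1) *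
        ∏ p ∈ m.primeFactors, ((p : ℝ) ^ m.factorization p) ^ ε := Finset.prod_mul_distrib
    _ ≤ _ := by
      refine mul_le_mul_of_nonneg_right ?_ (Finset.prod_nonneg fun _ _ => by positivity)
      rw [← Finset.prod_filter, Finset.prod_const]
      refine pow_le_pow_right₀ hD1 ?_
      calc _ ≤ (Finset.range P).card := Finset.card_le_card fun p hp => by
            simpa using (Finset.mem_filter.1 hp).2
        _ = P := Finset.card_range P

/-- The sum of the `s` with `s² ∣ m`, an upper bound for each of them. -/
def sqDivisorSum (m : ℕ) : ℕ := ∑ s ∈ m.divisors with s ^ 2 ∣ m, s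

theorem le_sqDivisorSum {s m : ℕ} (hm : m ≠ 0) (h : s ^ 2 ∣ m) : s ≤ sqDivisorSum m :=
  Finset.single_le_sum (f := fun s => s) (fun _ _ => Nat.zero_le _)
    (Finset.mem_filter.2 ⟨Nat.mem_divisors.2 ⟨(Dvd.intro_left _ (sq s).symm).trans h, hm⟩, h⟩)

/-- The pairs of positive integers with product at most `N`. -/
def hyperbola (N : ℕ) : Finset (ℕ × ℕ) :=
  (Finset.Icc 1 N ×ˢ Finset.Icc 1 N).filter fun p => p.1 * p.2 ≤ N

theorem mem_hyperbola {N n m : ℕ} (hn : 0 < n) (hm : 0 < m) (h : n * m ≤ N) :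
    (n, m) ∈ hyperbola N := by
  simp only [hyperbola, Finset.mem_filter, Finset.mem_product, Finset.mem_Icc]
  exact ⟨⟨⟨hn, (Nat.le_mul_of_pos_right n hm).trans h⟩, hm, (Nat.le_mul_of_pos_left m hn).trans h⟩,
    h⟩

theorem sum_sqDivisorSum_hyperbola_le (N : ℕ) :
    (∑ p ∈ hyperbola N, (sqDivisorSum p.2 : ℝ)) ≤ N * (1 + Real.log N) ^ 2 := by
  have h1 : ∑ p ∈ hyperbola N, sqDivisorSum p.2 ≤
      ∑ n ∈ Finset.Icc 1 N, ∑ s ∈ Finset.Icc 1 N, N / n / s ^ 2 * s := by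
    rw [hyperbola, Finset.sum_filter, Finset.sum_product]
    refine Finset.sum_le_sum fun n hn => ?_
    rw [← Finset.sum_filter]
    have hn0 : 0 < n := (Finset.mem_Icc.1 hn).1
    calc ∑ m ∈ Finset.Icc 1 N with n * m ≤ N, sqDivisorSum m
        ≤ ∑ m ∈ Finset.Ioc 0 (N / n), ∑ s ∈ Finset.Icc 1 N, if s ^ 2 ∣ m then s else 0 := by
          refine (Finset.sum_le_sum_of_subset (t := Finset.Ioc 0 (N / n)) ?_).trans
            (Finset.sum_le_sum ?_)
          · intro m hm
            simp only [Finset.mem_filter, Finset.mem_Icc] at hm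
            rw [Finset.mem_Ioc, Nat.le_div_iff_mul_le hn0]
            exact ⟨hm.1.1, by linarith [hm.2, mul_comm n m]⟩
          · intro m hm
            rw [sqDivisorSum, ← Finset.sum_filter]
            refine Finset.sum_le_sum_of_subset fun s hs => ?_
            simp only [Finset.mem_filter, Nat.mem_divisors, Finset.mem_Icc] at hs ⊢
            rw [Finset.mem_Ioc] at hm
            refine ⟨⟨Nat.pos_of_dvd_of_pos hs.1.1 hm.1, ?_⟩, hs.2⟩
            exact ((Nat.le_of_dvd hm.1 hs.1.1).trans hm.2).trans (Nat.div_le_self _ _)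
      _ = ∑ s ∈ Finset.Icc 1 N, N / n / s ^ 2 * s := by
          rw [Finset.sum_comm]
          refine Finset.sum_congr rfl fun s _ => ?_
          rw [← Finset.sum_filter, Finset.sum_const, Nat.Ioc_filter_dvd_card_eq_div, smul_eq_mul]
  have hH : ∑ n ∈ Finset.Icc 1 N, (n : ℝ)⁻¹ ≤ 1 + Real.log N := by
    have := harmonic_le_one_add_log N
    rw [harmonic_eq_sum_Icc] at this
    push_cast at this
    exact this
  have hH0 : 0 ≤ ∑ n ∈ Finset.Icc 1 N, (n : ℝ)⁻¹ := Finset.sum_nonneg fun _ _ => by positivity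
  calc (∑ p ∈ hyperbola N, (sqDivisorSum p.2 : ℝ))
      = ((∑ p ∈ hyperbola N, sqDivisorSum p.2 : ℕ) : ℝ) := by push_cast; rfl
    _ ≤ ((∑ n ∈ Finset.Icc 1 N, ∑ s ∈ Finset.Icc 1 N, N / n / s ^ 2 * s : ℕ) : ℝ) := by
        exact_mod_cast h1
    _ = ∑ n ∈ Finset.Icc 1 N, ∑ s ∈ Finset.Icc 1 N, ((N / n / s ^ 2 : ℕ) : ℝ) * s := by
        push_cast; rfl
    _ ≤ ∑ n ∈ Finset.Icc 1 N, ∑ s ∈ Finset.Icc 1 N, (N : ℝ) * ((n : ℝ)⁻¹ * (s : ℝ)⁻¹) := by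
        refine Finset.sum_le_sum fun n hn => Finset.sum_le_sum fun s hs => ?_
        have hs0 : (0 : ℝ) < s := by exact_mod_cast (Finset.mem_Icc.1 hs).1
        have hn0 : (0 : ℝ) < n := by exact_mod_cast (Finset.mem_Icc.1 hn).1
        have : ((N / n / s ^ 2 : ℕ) : ℝ) ≤ (N : ℝ) / n / (s : ℝ) ^ 2 := by
          refine Nat.cast_div_le.trans ?_
          push_cast
          gcongr
          exact Nat.cast_div_le
        calc _ ≤ (N : ℝ) / n / (s : ℝ) ^ 2 * s := by gcongr
          _ = _ := by field_simp
    _ = N * (∑ n ∈ Finset.Icc 1 N, (n : ℝ)⁻¹) ^ 2 := by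
        rw [sq, Finset.sum_mul_sum, Finset.mul_sum]
        simp only [Finset.mul_sum]
    _ ≤ _ := by gcongr

/-- The index set for the classes: a pair `(n, m)` with `n m ≤ N`, a sign, two divisors `k, k'`
of `m`, a further divisor of `m`, and a residue bounded by `sqDivisorSum m`. -/
def codes (N : ℕ) : Finset (Σ _ : ℕ × ℕ, Bool × (ℕ × ℕ) × (ℕ × ℕ)) :=
  (hyperbola N).sigma fun p => Finset.univ ×ˢ (p.2.divisors ×ˢ p.2.divisors) ×ˢ
    (p.2.divisors ×ˢ Finset.range (sqDivisorSum p.2))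

theorem exists_card_codes_le : ∃ K : ℝ, 0 < K ∧ ∀ N : ℕ, N ≠ 0 →
    ((codes N).card : ℝ) ≤ K * (N : ℝ) ^ ((13 : ℝ) / 12) := by
  obtain ⟨C, hC, hdiv⟩ := exists_card_divisors_le_rpow (ε := 1 / 60) (by norm_num)
  refine ⟨2 * C ^ 3 * 61 ^ 2, by positivity, fun N hN => ?_⟩
  have hN1 : (1 : ℝ) ≤ N := by exact_mod_cast Nat.one_le_iff_ne_zero.2 hN
  set E : ℝ := (N : ℝ) ^ ((1 : ℝ) / 60) with hE
  have hE1 : 1 ≤ E := Real.one_le_rpow hN1 (by norm_num)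
  have hlog : 1 + Real.log N ≤ 61 * E := by
    have : Real.log N ≤ E / (1 / 60) := Real.log_le_rpow_div (by positivity) (by norm_num)
    linarith
  have hlog0 : 0 ≤ Real.log N := Real.log_nonneg hN1
  calc ((codes N).card : ℝ)
      = ∑ p ∈ hyperbola N, 2 * (p.2.divisors.card : ℝ) ^ 3 * (sqDivisorSum p.2 : ℝ) := by
        rw [codes, Finset.card_sigma]
        push_cast
        refine Finset.sum_congr rfl fun p _ => ?_
        simp only [Finset.card_product, Finset.card_univ, Fintype.card_bool, Finset.card_range]
        push_cast
        ring
    _ ≤ ∑ p ∈ hyperbola N, 2 * (C * E) ^ 3 * (sqDivisorSum p.2 : ℝ) := by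
        refine Finset.sum_le_sum fun p hp => ?_
        simp only [hyperbola, Finset.mem_filter, Finset.mem_product, Finset.mem_Icc] at hp
        have hp0 : p.2 ≠ 0 := by omega
        have : (p.2.divisors.card : ℝ) ≤ C * E := by
          refine (hdiv _ hp0).trans (mul_le_mul_of_nonneg_left ?_ hC.le)
          exact Real.rpow_le_rpow (by positivity) (by exact_mod_cast hp.1.2.2) (by norm_num)
        gcongr
    _ = 2 * (C * E) ^ 3 * ∑ p ∈ hyperbola N, (sqDivisorSum p.2 : ℝ) := by rw [Finset.mul_sum]
    _ ≤ 2 * (C * E) ^ 3 * (N * (61 * E) ^ 2) := by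
        gcongr
        exact (sum_sqDivisorSum_hyperbola_le N).trans (by gcongr)
    _ = 2 * C ^ 3 * 61 ^ 2 * (N * E ^ 5) := by ring
    _ = _ := by
        congr 1
        rw [hE, ← Real.rpow_natCast, ← Real.rpow_mul (by positivity)]
        conv_lhs => rw [← Real.rpow_one (N : ℝ)]
        rw [Real.rpow_one, ← Real.rpow_one_add' (by positivity) (by norm_num)]
        norm_num

/-! ### Counting the classes -/

/-- Every class in `type2Classes X` is represented by a multiple `n g h` with `(f, g, h)` a frame
and `|n| k k' l ≤ 2 X ^ (5 / 18)`: the product of the bounds for `4 I = 3 n² k k' l²` and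
`-disc f = k k'` bounds `(n k k' l)²`. -/
theorem exists_frame_of_mem_type2Classes {X : ℝ} (hX : 0 < X) {w : QuarticClass}
    (hw : w ∈ type2Classes X) : ∃ (n : ℤ) (k k' l : ℕ) (f g h : Quadratic), n ≠ 0 ∧
      IsFrame k k' l f g h ∧ n.natAbs * (k * k' * l) ≤ ⌊2 * X ^ ((5 : ℝ) / 18)⌋₊ ∧
      w = Quotient.mk Quartic.setoid (Quartic.smul n (Quartic.prod g h)) := by
  obtain ⟨F, hFw, -, hI, f, pf, hf, hd, hdisc, ht⟩ := hw
  obtain ⟨n, k, k', l, g, h, hn, H, rfl⟩ := exists_frame_of_isType2 pf hf hd ht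
  refine ⟨n, k, k', l, f, g, h, hn, H, ?_, hFw.symm⟩
  have e1 : 4 * ((Quartic.smul n (Quartic.prod g h)).I : ℝ) = 3 * n ^ 2 * k * k' * l ^ 2 := by
    exact_mod_cast H.four_I n
  have e2 : |(f.disc : ℝ)| = k * k' := by
    rw [H.disc_f]
    push_cast
    rw [abs_neg, abs_of_nonneg (by positivity)]
  rw [e2] at hdisc
  apply Nat.le_floor
  push_cast
  have hsq : ((n.natAbs : ℝ)) ^ 2 = (n : ℝ) ^ 2 := by
    rw [Nat.cast_natAbs]; push_cast; exact sq_abs _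
  refine abs_le_of_sq_le_sq' ?_ (by positivity) |>.2
  calc ((n.natAbs : ℝ) * (k * k' * l)) ^ 2 = (k * k') * (n ^ 2 * k * k' * l ^ 2) := by
        rw [mul_pow, hsq]; ring
    _ ≤ X ^ ((2 : ℝ) / 9) * (4 * X ^ ((1 : ℝ) / 3)) := by
        refine mul_le_mul hdisc ?_ (by positivity) (by positivity)
        have : 0 < X ^ ((1 : ℝ) / 3) := by positivity
        linarith
    _ = (2 * X ^ ((5 : ℝ) / 18)) ^ 2 := by
        have h1 : X ^ ((2 : ℝ) / 9) * X ^ ((1 : ℝ) / 3) = X ^ ((5 : ℝ) / 9) := by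
          rw [← Real.rpow_add hX]; norm_num
        have h2 : (X ^ ((5 : ℝ) / 18)) ^ 2 = X ^ ((5 : ℝ) / 9) := by
          rw [← Real.rpow_natCast, ← Real.rpow_mul hX.le]; norm_num
        rw [mul_pow, h2, ← h1]
        ring

theorem type2Classes_finite_and_ncard_le {X : ℝ} (hX : 0 < X) : (type2Classes X).Finite ∧
    (type2Classes X).ncard ≤ (codes ⌊2 * X ^ ((5 : ℝ) / 18)⌋₊).card := by
  set N := ⌊2 * X ^ ((5 : ℝ) / 18)⌋₊
  choose s hs inv hinv huniq using exists_frame_invariant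
  -- the code determines the class: `k, k'` are recorded and `l = m / (k k')`
  have hcode : ∀ w ∈ type2Classes X, ∃ c ∈ codes N, ∃ (n : ℤ) (k k' l : ℕ) (f g h : Quadratic),
      IsFrame k k' l f g h ∧ w = Quotient.mk Quartic.setoid (Quartic.smul n (Quartic.prod g h)) ∧
      c = ⟨(n.natAbs, k * k' * l), decide (0 < n), (k, k'), inv k k' l (f, g, h)⟩ := by
    intro w hw
    obtain ⟨n, k, k', l, f, g, h, hn, H, hle, hwe⟩ := exists_frame_of_mem_type2Classes hX hw
    refine ⟨_, ?_, n, k, k', l, f, g, h, H, hwe, rfl⟩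
    have h1 := H.k_pos
    have h2 := H.k'_pos
    have h3 := H.l_pos
    have hm : 0 < k * k' * l := by positivity
    obtain ⟨d1, d2⟩ := hinv k k' l f g h H
    simp only [codes, Finset.mem_sigma, Finset.mem_product, Finset.mem_univ, true_and,
      Nat.mem_divisors, Finset.mem_range]
    exact ⟨mem_hyperbola (Int.natAbs_pos.2 hn) hm hle,
      ⟨⟨⟨k' * l, by ring⟩, hm.ne'⟩, ⟨k * l, by ring⟩, hm.ne'⟩, ⟨d1, hm.ne'⟩,
      d2.trans_le (le_sqDivisorSum hm.ne' (hs k k' l))⟩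
  have : ∃ F : QuarticClass → Σ _ : ℕ × ℕ, Bool × (ℕ × ℕ) × (ℕ × ℕ),
      Set.MapsTo F (type2Classes X) (codes N) ∧ Set.InjOn F (type2Classes X) := by
    choose! F hF hFc using hcode
    refine ⟨F, hF, fun w hw w' hw' he => ?_⟩
    obtain ⟨n, k, k', l, f, g, h, H, rfl, e⟩ := hFc w hw
    obtain ⟨n', k₁, k₁', l', f', g', h', H', rfl, e'⟩ := hFc w' hw'
    rw [e, e'] at he
    simp only [Sigma.mk.injEq, Prod.mk.injEq, heq_eq_eq, decide_eq_decide] at he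
    obtain ⟨⟨hn, hm⟩, hsign, ⟨rfl, rfl⟩, hi⟩ := he
    obtain rfl : n = n' := by omega
    obtain rfl : l = l' := Nat.eq_of_mul_eq_mul_left (Nat.mul_pos H.k_pos H.k'_pos) hm
    exact Quotient.sound (huniq k k' l f g h f' g' h' H H' hi n)
  obtain ⟨F, hF, hinj⟩ := this
  refine ⟨Set.Finite.of_injOn hF hinj (codes N).finite_toSet, ?_⟩
  rw [← Set.ncard_coe_finset]
  exact Set.ncard_le_ncard_of_injOn F hF hinj (codes N).finite_toSet

end BinForm

theorem proposition9p3 :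
    (∀ X : ℝ, 0 < X → (BinForm.type2Classes X).Finite) ∧
      (fun X : ℝ => ((BinForm.type2Classes X).ncard : ℝ)) =O[Filter.atTop]
        (fun X : ℝ => X ^ ((11 : ℝ) / 36) * Real.log X) := by
  refine ⟨fun X hX => (BinForm.type2Classes_finite_and_ncard_le hX).1, ?_⟩
  obtain ⟨K, hK, hcodes⟩ := BinForm.exists_card_codes_le
  refine Asymptotics.IsBigO.of_bound (K * 2 ^ ((13 : ℝ) / 12)) ?_
  filter_upwards [Filter.eventually_ge_atTop (Real.exp 1)] with X hX
  have hX1 : 1 ≤ X := (Real.one_le_exp zero_le_one).trans hX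
  have hX0 : 0 < X := by linarith
  have hlog : 1 ≤ Real.log X := (Real.le_log_iff_exp_le hX0).2 hX
  have hpow : 1 ≤ X ^ ((5 : ℝ) / 18) := Real.one_le_rpow hX1 (by norm_num)
  have hN : ⌊2 * X ^ ((5 : ℝ) / 18)⌋₊ ≠ 0 := (Nat.floor_pos.2 (by linarith)).ne'
  rw [Real.norm_of_nonneg (by positivity), Real.norm_of_nonneg (by positivity)]
  calc ((BinForm.type2Classes X).ncard : ℝ)
      ≤ (BinForm.codes ⌊2 * X ^ ((5 : ℝ) / 18)⌋₊).card := by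
        exact_mod_cast (BinForm.type2Classes_finite_and_ncard_le hX0).2
    _ ≤ K * (⌊2 * X ^ ((5 : ℝ) / 18)⌋₊ : ℝ) ^ ((13 : ℝ) / 12) := hcodes _ hN
    _ ≤ K * (2 * X ^ ((5 : ℝ) / 18)) ^ ((13 : ℝ) / 12) := by
        gcongr
        exact Nat.floor_le (by positivity)
    _ = K * 2 ^ ((13 : ℝ) / 12) * X ^ ((65 : ℝ) / 216) := by
        rw [Real.mul_rpow (by norm_num) (by positivity), ← Real.rpow_mul hX0.le, mul_assoc]
        norm_num
    _ ≤ K * 2 ^ ((13 : ℝ) / 12) * (X ^ ((11 : ℝ) / 36) * Real.log X) := by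
        gcongr
        calc X ^ ((65 : ℝ) / 216) ≤ X ^ ((11 : ℝ) / 36) :=
              Real.rpow_le_rpow_of_exponent_le hX1 (by norm_num)
          _ ≤ _ := le_mul_of_one_le_right (by positivity) hlog
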